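/- **Action of the permutation-phase twirl.** Let $d,t\in\mathbb N$, let $A=(\mathbb C^d)^{\otimes t}$ with computational basis $|\mathbf x\rangle$, $\mathbf x\in[d]^t$, and let $E$ be a finite-dimensional complex Hilbert space. Let $\Lambda=\sum_{\mathbf x\text{ distinct}}|\mathbf x\rangle\langle\mathbf x|$, the sum over the tuples $\mathbf x$ with pairwise different entries. For $\pi\in S_t$ let $R_\pi|\mathbf a\rangle=|\mathbf a_{\pi^{-1}}\rangle$ be the operator that permutes the tensor factors. For a partition $\lambda\vdash t$ let $V_\lambda$ be the Specht module of $S_t$ (with its invariant inner product), and let $W_\lambda=\mathrm{Hom}_{S_t}(V_\lambda,A)$ be the Weyl module, with inner product $\langle f,g\rangle=\mathrm{Tr}(f^\dagger g)/\dim V_\lambda$, embedded together by $W_\lambda\otimes V_\lambda\to A$, $f\otimes v\mapsto f(v)$, with image $P_\lambda$. Let $\Lambda^{(\lambda)}_{W_\lambda}$ be the operator $f\mapsto\Lambda f$ on $W_\lambda$, and let $\sigma_\lambda=\Lambda^{(\lambda)}_{W_\lambda}/\mathrm{Tr}[\Lambda^{(\lambda)}_{W_\lambda}]$. Let $|\phi\rangle\in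 A\otimes E$ be a unit vector with $(\Lambda\otimes 1_E)|\phi\rangle=|\phi\rangle$. Then: 1. the embeddings are isometric and $A=\bigoplus_{\lambda\vdash t}P_\lambda$, $P_\lambda= W_\lambda\otimes V_\lambda$, is an orthogonal direct sum; 2. $\Lambda=\sum_{\lambda\vdash t}\Lambda^{(\lambda)}_{W_\lambda}\otimes 1_{V_\lambda}$, and each $\Lambda^{(\lambda)}_{W_\lambda}$ is an orthogonal projection on $W_\lambda$ with nonzero trace (so that $\sigma_\lambda$ is the maximally mixed state on its range); 3. $$\mathop{\mathbb E}_{P,F}\,\big((PF)^{\otimes t}\otimes 1_E\big)\,|\phi\rangle\langle\phi|\,\big((PF)^{\otimes t}\otimes 1_E\big)^\dagger=\sum_{\lambda\vdash t}\sigma_\lambda\otimes\mathrm{Tr}_{W_\lambda}\big[1_{P_\lambda}|\phi\rangle\langle\phi|1_{P_\lambda}\big],$$ where $P=P_\pi:|x\rangle\mapsto|\pi(x)\rangle$ for a uniformly random $\pi\in S_d$ and $F=F_f:|x\rangle\mapsto(-1)^{f(x)}|x\rangle$ for an independent, uniformly random $f:[d]\to\{0,1\}$. Here $1_{P_\lambda}$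 is the orthogonal projection onto $P_\lambda$ (tensored with $1_E$), $\mathrm{Tr}_{W_\lambda}$ is the partial trace from $W_\lambda\otimes V_\lambda\otimes E$ to $V_\lambda\otimes E$, and operators on $W_\lambda\otimes V_\lambda\otimes E$ are regarded as operators on $A\otimes E$ that vanish on the orthogonal complement of $P_\lambda\otimes E$. -/

import Mathlib

open scoped TensorProduct

noncomputable section

namespace SchurWeyl

/-! ### Tensor powers, tensor-power operators and the permutation representation -/

/-- The Hilbert space `(ℂⁿ)^{⊗t}`, in its computational basis `|x₁,…,x_t⟩` indexed by the
tuples `x : Fin t → Fin n`. -/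
abbrev Tens (n t : ℕ) : Type := EuclideanSpace ℂ (Fin t → Fin n)

/-- The computational basis state `|x⟩`. -/
def ket {n t : ℕ} (x : Fin t → Fin n) : Tens n t := EuclideanSpace.single x 1

/-- The operator `M^{⊗t}` on `(ℂⁿ)^{⊗t}`, with `⟨x| M^{⊗t} |y⟩ = ∏ᵢ ⟨xᵢ| M |yᵢ⟩`. -/
def tensPow {n : ℕ} (t : ℕ) (M : Matrix (Fin n) (Fin n) ℂ) : Tens n t →ₗ[ℂ] Tens n t :=
  Matrix.toEuclideanLin (Matrix.of fun x y : Fin t → Fin n => ∏ i, M (x i) (y i))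

/-- The operator `R_π` permuting the tensor factors. -/
def permOp {n t : ℕ} (π : Equiv.Perm (Fin t)) : Tens n t →ₗ[ℂ] Tens n t where
  toFun ψ := WithLp.toLp 2 fun b => ψ (b ∘ π)
  map_add' _ _ := rfl
  map_smul' _ _ := rfl

/-- `R_π |a⟩ = |a_{π⁻¹}⟩`, where `(a_{π⁻¹})ᵢ = a_{π⁻¹(i)}`. -/
theorem permOp_ket {n t : ℕ} (π : Equiv.Perm (Fin t)) (a : Fin t → Fin n) :
    permOp π (ket a) = ket (a ∘ ⇑π⁻¹) := by
  ext b
  have h : b ∘ ⇑π = a ↔ b = a ∘ ⇑π⁻¹ := by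
    constructor
    · rintro rfl
      funext i
      simp
    · rintro rfl
      funext i
      simp
  change (ket a : Tens n t) (b ∘ ⇑π) = ket (a ∘ ⇑π⁻¹) b
  simp only [ket, PiLp.single_apply, h]

theorem permOp_mul {n t : ℕ} (π τ : Equiv.Perm (Fin t)) (ψ : Tens n t) :
    permOp (π * τ) ψ = permOp π (permOp τ ψ) := rfl

/-! ### The distinct subspace -/

/-- The projector `Λ = ∑_{x distinct} |x⟩⟨x|`. -/
def distinctProj (n t : ℕ) : Tens n t →ₗ[ℂ] Tens n t :=
  open scoped Classical in
  ∑ x : Fin t → Fin n with Function.Injective x,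
    (InnerProductSpace.rankOne ℂ (ket x) (ket x)).toLinearMap

open scoped Classical in
theorem distinctProj_apply {n t : ℕ} (ψ : Tens n t) (x : Fin t → Fin n) :
    distinctProj n t ψ x = if Function.Injective x then ψ x else 0 := by
  have hk : ∀ b : Fin t → Fin n,
      (InnerProductSpace.rankOne ℂ (ket b) (ket b)).toLinearMap ψ x =
        if x = b then ψ b else 0 := by
    intro b
    change (inner ℂ (ket b) ψ • ket b : Tens n t) x = _
    rw [ket, EuclideanSpace.inner_single_left, PiLp.smul_apply, PiLp.single_apply]
    simp
  simp only [distinctProj, LinearMap.sum_apply, WithLp.ofLp_sum, Finset.sum_apply, hk,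
    Finset.sum_ite_eq, Finset.mem_filter, Finset.mem_univ, true_and]

theorem distinctProj_permOp {n t : ℕ} (π : Equiv.Perm (Fin t)) (ψ : Tens n t) :
    distinctProj n t (permOp π ψ) = permOp π (distinctProj n t ψ) := by
  classical
  ext x
  have h : Function.Injective (x ∘ ⇑π) ↔ Function.Injective x := by
    constructor
    · intro h
      have := h.comp π.symm.injective
      simpa [Function.comp_assoc] using this
    · intro h
      exact h.comp π.injective
  have e : permOp π (distinctProj n t ψ) x = distinctProj n t ψ (x ∘ ⇑π) := rfl
  rw [e, distinctProj_apply, distinctProj_apply]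
  simp only [h]
  rfl

/-! ### Specht modules -/

/-- The row lengths of the Young diagram of a partition, in decreasing order. -/
def rowLens {t : ℕ} (μ : t.Partition) : List ℕ := μ.parts.sort (· ≥ ·)

/-- The boxes of the Young diagram of `μ`: a row, and a position in that row. -/
abbrev Cell {t : ℕ} (μ : t.Partition) : Type :=
  Σ i : Fin (rowLens μ).length, Fin ((rowLens μ).get i)

/-- Young tableaux of shape `μ`: the boxes filled bijectively with `1, …, t`; `T k` is the box
that holds the entry `k`. -/
abbrev Tableau {t : ℕ} (μ : t.Partition) : Type := Fin t ≃ Cell μ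

/-- The row that holds the entry `k`. The function `T.row` determines, and is determined by, the
tabloid of `T` (its class up to permuting entries within rows). -/
def Tableau.row {t : ℕ} {μ : t.Partition} (T : Tableau μ) : Fin t → Fin (rowLens μ).length :=
  fun k => (T k).1

/-- The column that holds the entry `k`. -/
def Tableau.col {t : ℕ} {μ : t.Partition} (T : Tableau μ) : Fin t → ℕ :=
  fun k => ((T k).2 : ℕ)

/-- The polytabloid `∑_q sign(q) {qT}`, where `q` runs over the column stabilizer of `T`. The
tabloid `{T}` is represented by the basis vector `|T.row⟩`, on which `S_t` acts by
`R_q |T.row⟩ = |(qT).row⟩`. -/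
def polytabloid {t : ℕ} {μ : t.Partition} (T : Tableau μ) : Tens (rowLens μ).length t :=
  open scoped Classical in
  ∑ q : Equiv.Perm (Fin t) with ∀ k, T.col (q k) = T.col k,
    ((Equiv.Perm.sign q : ℤ) : ℂ) • permOp q (ket T.row)

/-- The span of the polytabloids of shape `μ`. -/
def spechtSubmodule {t : ℕ} (μ : t.Partition) : Submodule ℂ (Tens (rowLens μ).length t) :=
  Submodule.span ℂ (Set.range (polytabloid (μ := μ)))

theorem permOp_polytabloid {t : ℕ} {μ : t.Partition} (π : Equiv.Perm (Fin t)) (T : Tableau μ) :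
    permOp π (polytabloid T) = polytabloid (μ := μ) (π⁻¹.trans T) := by
  classical
  have hrow : ket (Tableau.row (μ := μ) (π⁻¹.trans T)) = permOp π (ket (Tableau.row T)) := by
    rw [permOp_ket]
    rfl
  unfold polytabloid
  rw [map_sum]
  refine Finset.sum_bij' (fun q _ => π * q * π⁻¹) (fun q _ => π⁻¹ * q * π) ?_ ?_ ?_ ?_ ?_
  · intro q hq
    refine Finset.mem_filter.2 ⟨Finset.mem_univ _, fun k => ?_⟩
    change ((T (π⁻¹ (π (q (π⁻¹ k))))).2 : ℕ) = (T (π⁻¹ k)).2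
    rw [Equiv.Perm.inv_def, Equiv.symm_apply_apply]
    exact (Finset.mem_filter.1 hq).2 (π⁻¹ k)
  · intro q hq
    refine Finset.mem_filter.2 ⟨Finset.mem_univ _, fun k => ?_⟩
    have h : ((T (π⁻¹ (q (π k)))).2 : ℕ) = (T (π⁻¹ (π k))).2 := (Finset.mem_filter.1 hq).2 (π k)
    rw [Equiv.Perm.inv_def, Equiv.symm_apply_apply] at h
    exact h
  · intro q _
    group
  · intro q _
    group
  · intro q _
    rw [map_smul, hrow, ← permOp_mul, ← permOp_mul]
    congr 2
    · rw [map_mul, map_mul, map_inv, mul_right_comm, mul_inv_cancel, one_mul]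
    · group

theorem permOp_mem_spechtSubmodule {t : ℕ} (μ : t.Partition) (π : Equiv.Perm (Fin t)) :
    ∀ v ∈ spechtSubmodule μ, permOp π v ∈ spechtSubmodule μ := by
  intro v hv
  unfold spechtSubmodule at hv
  induction hv using Submodule.span_induction with
  | mem v h =>
    obtain ⟨T, rfl⟩ := h
    rw [permOp_polytabloid]
    exact Submodule.subset_span ⟨_, rfl⟩
  | zero => simp
  | add v w _ _ hv hw =>
    rw [map_add]
    exact add_mem hv hw
  | smul c v _ hv =>
    rw [map_smul]
    exact Submodule.smul_mem _ c hv

/-- The Specht module `V_μ`, a Hilbert space with the inner product of the tabloid space. -/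
def Specht {t : ℕ} (μ : t.Partition) : Type := spechtSubmodule μ

instance spechtNormedAddCommGroup {t : ℕ} (μ : t.Partition) : NormedAddCommGroup (Specht μ) :=
  Submodule.normedAddCommGroup (spechtSubmodule μ)

instance spechtInnerProductSpace {t : ℕ} (μ : t.Partition) : InnerProductSpace ℂ (Specht μ) :=
  Submodule.innerProductSpace (spechtSubmodule μ)

/-- The inclusion of the Specht module in the tabloid space. -/
def Specht.incl {t : ℕ} (μ : t.Partition) : Specht μ →ₗᵢ[ℂ] Tens (rowLens μ).length t where
  toFun v := Subtype.val v
  map_add' _ _ := rfl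
  map_smul' _ _ := rfl
  norm_map' _ := rfl

instance spechtFiniteDimensional {t : ℕ} (μ : t.Partition) : FiniteDimensional ℂ (Specht μ) :=
  FiniteDimensional.of_injective (Specht.incl μ).toLinearMap (Specht.incl μ).injective

/-- The unitary action `R_π^{(μ)}` of `S_t` on the Specht module `V_μ`, by permuting the entries of
the tableaux. -/
def spechtAct {t : ℕ} (μ : t.Partition) (π : Equiv.Perm (Fin t)) :
    Specht μ →ₗ[ℂ] Specht μ where
  toFun v := ⟨permOp π (Subtype.val v), permOp_mem_spechtSubmodule μ π _ (Subtype.prop v)⟩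
  map_add' _ _ := Subtype.ext (map_add (permOp π) _ _)
  map_smul' _ _ := Subtype.ext (map_smul (permOp π) _ _)

/-! ### Weyl modules -/

/-- The space `Hom_{S_t}(V_μ, (ℂ^d)^{⊗t})` of intertwiners. -/
def intertwiners (d : ℕ) {t : ℕ} (μ : t.Partition) :
    Submodule ℂ (Specht μ →ₗ[ℂ] Tens d t) where
  carrier := {f | ∀ π : Equiv.Perm (Fin t), permOp π ∘ₗ f = f ∘ₗ spechtAct μ π}
  add_mem' {f g} hf hg π := by
    rw [LinearMap.comp_add, LinearMap.add_comp, hf π, hg π]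
  zero_mem' π := by simp
  smul_mem' c f hf π := by
    rw [LinearMap.comp_smul, LinearMap.smul_comp, hf π]

/-- The inner product `⟨f, g⟩ = Tr(f† g) / dim V_μ` on the intertwiners (so that, by Schur's lemma,
`f† g` is `⟨f, g⟩` times the identity of `V_μ`). -/
@[reducible]
def weylCore (d : ℕ) {t : ℕ} (μ : t.Partition) :
    InnerProductSpace.Core ℂ (intertwiners d μ) where
  inner f g := (Module.finrank ℂ (Specht μ) : ℂ)⁻¹ *
    LinearMap.trace ℂ (Specht μ)
      (LinearMap.adjoint (𝕜 := ℂ) (E := Specht μ) (F := Tens d t) f.1 ∘ₗ g.1)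
  conj_inner_symm f g := by
    simp only [map_mul, map_inv₀, map_natCast]
    congr 1
    rw [LinearMap.trace_eq_sum_inner _ (stdOrthonormalBasis ℂ (Specht μ)),
      LinearMap.trace_eq_sum_inner _ (stdOrthonormalBasis ℂ (Specht μ)), map_sum]
    refine Finset.sum_congr rfl fun i _ => ?_
    simp [LinearMap.adjoint_inner_right]
  re_inner_nonneg f := by
    rw [LinearMap.trace_eq_sum_inner _ (stdOrthonormalBasis ℂ (Specht μ))]
    simp only [LinearMap.comp_apply, LinearMap.adjoint_inner_right, inner_self_eq_norm_sq_to_K]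
    have h : (Module.finrank ℂ (Specht μ) : ℂ)⁻¹ * ∑ i, ((‖f.1 (stdOrthonormalBasis ℂ
        (Specht μ) i)‖ : ℝ) : ℂ) ^ 2 = (((Module.finrank ℂ (Specht μ) : ℝ)⁻¹ *
          ∑ i, ‖f.1 (stdOrthonormalBasis ℂ (Specht μ) i)‖ ^ 2 : ℝ) : ℂ) := by
      push_cast
      rfl
    refine le_of_le_of_eq ?_ (congrArg Complex.re h).symm
    rw [Complex.ofReal_re]
    positivity
  add_left f g h := by
    simp [map_add, LinearMap.add_comp, mul_add]
  smul_left f g r := by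
    have h : LinearMap.adjoint (𝕜 := ℂ) (E := Specht μ) (F := Tens d t) (r • f).1 =
        (starRingEnd ℂ r) • LinearMap.adjoint (𝕜 := ℂ) (E := Specht μ) (F := Tens d t) f.1 :=
      map_smulₛₗ _ r f.1
    rw [h, LinearMap.smul_comp, map_smul, smul_eq_mul]
    ring
  definite f h := by
    have key : ∀ v, f.1 v = 0 := by
      rcases mul_eq_zero.1 h with h | h
      · rw [inv_eq_zero, Nat.cast_eq_zero, Module.finrank_zero_iff] at h
        intro v
        rw [Subsingleton.elim v 0, map_zero]
      · rw [LinearMap.trace_eq_sum_inner _ (stdOrthonormalBasis ℂ (Specht μ))] at h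
        simp only [LinearMap.comp_apply, LinearMap.adjoint_inner_right,
          inner_self_eq_norm_sq_to_K] at h
        have h' : ∑ i, ‖f.1 (stdOrthonormalBasis ℂ (Specht μ) i)‖ ^ 2 = 0 := by
          have e : ((∑ i, ‖f.1 (stdOrthonormalBasis ℂ (Specht μ) i)‖ ^ 2 : ℝ) : ℂ) = 0 := by
            push_cast
            exact h
          exact_mod_cast e
        rw [Finset.sum_eq_zero_iff_of_nonneg (fun _ _ => by positivity)] at h'
        have hz : f.1 = 0 := by
          refine (stdOrthonormalBasis ℂ (Specht μ)).toBasis.ext fun i => ?_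
          simpa using h' i (Finset.mem_univ i)
        intro v
        rw [hz, LinearMap.zero_apply]
    exact Subtype.ext (LinearMap.ext key)

/-- The Weyl module `W_μ = Hom_{S_t}(V_μ, (ℂ^d)^{⊗t})`, a Hilbert space with the above inner
product: the multiplicity space of the Specht module `V_μ` in `(ℂ^d)^{⊗t}`. The unitary group acts
on it by `f ↦ U^{⊗t} ∘ f`. -/
def Weyl (d : ℕ) {t : ℕ} (μ : t.Partition) : Type := intertwiners d μ

instance weylNormedAddCommGroup (d : ℕ) {t : ℕ} (μ : t.Partition) :
    NormedAddCommGroup (Weyl d μ) := (weylCore d μ).toNormedAddCommGroup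

instance weylInnerProductSpace (d : ℕ) {t : ℕ} (μ : t.Partition) :
    InnerProductSpace ℂ (Weyl d μ) := InnerProductSpace.ofCore (weylCore d μ).toCore

/-- An element of the Weyl module, as a linear map `V_μ → (ℂ^d)^{⊗t}`. -/
def Weyl.toHom (d : ℕ) {t : ℕ} (μ : t.Partition) :
    Weyl d μ →ₗ[ℂ] Specht μ →ₗ[ℂ] Tens d t where
  toFun f := Subtype.val f
  map_add' _ _ := rfl
  map_smul' _ _ := rfl

theorem Weyl.inner_def (d : ℕ) {t : ℕ} (μ : t.Partition) (f g : Weyl d μ) :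
    inner ℂ f g = (Module.finrank ℂ (Specht μ) : ℂ)⁻¹ *
      LinearMap.trace ℂ (Specht μ) (LinearMap.adjoint (𝕜 := ℂ) (E := Specht μ) (F := Tens d t)
        (Weyl.toHom d μ f) ∘ₗ Weyl.toHom d μ g) := rfl

instance weylFiniteDimensional (d : ℕ) {t : ℕ} (μ : t.Partition) :
    FiniteDimensional ℂ (Weyl d μ) :=
  FiniteDimensional.of_injective (Weyl.toHom d μ) Subtype.val_injective

/-- The Schur-Weyl embedding `J_μ : W_μ ⊗ V_μ → (ℂ^d)^{⊗t}`, `f ⊗ v ↦ f v`. -/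
def embed (d : ℕ) {t : ℕ} (μ : t.Partition) : Weyl d μ ⊗[ℂ] Specht μ →ₗ[ℂ] Tens d t :=
  TensorProduct.lift (Weyl.toHom d μ)

/-- The subspace `P_μ = W_μ ⊗ V_μ` of `(ℂ^d)^{⊗t}`. -/
def blockSpace (d : ℕ) {t : ℕ} (μ : t.Partition) : Submodule ℂ (Tens d t) :=
  LinearMap.range (embed d μ)

/-- The orthogonal projection `1_{P_μ}`. -/
def blockProj (d : ℕ) {t : ℕ} (μ : t.Partition) : Tens d t →ₗ[ℂ] Tens d t :=
  (blockSpace d μ).starProjection.toLinearMap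

/-- The part `Λ^{(μ)}` of the distinct-subspace projector that acts on `W_μ`: as `Λ` commutes with
`S_t`, it acts on `W_μ = Hom_{S_t}(V_μ, (ℂ^d)^{⊗t})` by `f ↦ Λ ∘ f`. -/
def weylDistinct (d : ℕ) {t : ℕ} (μ : t.Partition) : Weyl d μ →ₗ[ℂ] Weyl d μ where
  toFun f := ⟨distinctProj d t ∘ₗ Subtype.val f, by
    intro π
    refine LinearMap.ext fun v => ?_
    have h := LinearMap.congr_fun (Subtype.prop f π) v
    simp only [LinearMap.comp_apply] at h ⊢
    rw [← distinctProj_permOp]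
    exact congrArg _ h⟩
  map_add' _ _ := Subtype.ext (LinearMap.comp_add _ _ _)
  map_smul' _ _ := Subtype.ext (LinearMap.comp_smul _ _ _)

/-- `σ_μ = Λ^{(μ)} / Tr Λ^{(μ)}`. -/
def sigma (d : ℕ) {t : ℕ} (μ : t.Partition) : Weyl d μ →ₗ[ℂ] Weyl d μ :=
  (LinearMap.trace ℂ (Weyl d μ) (weylDistinct d μ))⁻¹ • weylDistinct d μ

/-! ### Operators on composite systems -/

/-- The partial trace `Tr_W : L(W ⊗ X) → L(X)`, with `Tr_W[S ⊗ T] = Tr(S) T`. -/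
def partialTrace (W X : Type*) [AddCommGroup W] [Module ℂ W] [FiniteDimensional ℂ W]
    [AddCommGroup X] [Module ℂ X] [FiniteDimensional ℂ X] :
    (W ⊗[ℂ] X →ₗ[ℂ] W ⊗[ℂ] X) →ₗ[ℂ] (X →ₗ[ℂ] X) :=
  (TensorProduct.lid ℂ (X →ₗ[ℂ] X)).toLinearMap ∘ₗ
    LinearMap.rTensor (X →ₗ[ℂ] X) (LinearMap.trace ℂ W) ∘ₗ
      (homTensorHomEquiv ℂ W X W X).symm.toLinearMap

theorem partialTrace_map (W X : Type*) [AddCommGroup W] [Module ℂ W] [FiniteDimensional ℂ W]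
    [AddCommGroup X] [Module ℂ X] [FiniteDimensional ℂ X] (S : W →ₗ[ℂ] W) (T : X →ₗ[ℂ] X) :
    partialTrace W X (TensorProduct.map S T) = LinearMap.trace ℂ W S • T := by
  have h : TensorProduct.map S T = homTensorHomEquiv ℂ W X W X (S ⊗ₜ T) := by
    simp [homTensorHomEquiv_apply]
  simp only [partialTrace, LinearMap.comp_apply, h, LinearEquiv.coe_coe,
    LinearEquiv.symm_apply_apply, LinearMap.rTensor_tmul, TensorProduct.lid_tmul]

section Composite

variable (E : Type*) [NormedAddCommGroup E] [InnerProductSpace ℂ E] [FiniteDimensional ℂ E]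

/-- The isometric embedding `W_μ ⊗ (V_μ ⊗ E) → (ℂ^d)^{⊗t} ⊗ E` of the block `P_μ ⊗ E`. -/
def embedE (d : ℕ) {t : ℕ} (μ : t.Partition) :
    Weyl d μ ⊗[ℂ] (Specht μ ⊗[ℂ] E) →ₗ[ℂ] Tens d t ⊗[ℂ] E :=
  LinearMap.rTensor E (embed d μ) ∘ₗ
    (TensorProduct.assoc ℂ (Weyl d μ) (Specht μ) E).symm.toLinearMap

/-- The adjoint `(ℂ^d)^{⊗t} ⊗ E → W_μ ⊗ (V_μ ⊗ E)` of `embedE`, that is `J_μ† ⊗ 1_E`. -/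
def embedEAdj (d : ℕ) {t : ℕ} (μ : t.Partition) :
    Tens d t ⊗[ℂ] E →ₗ[ℂ] Weyl d μ ⊗[ℂ] (Specht μ ⊗[ℂ] E) :=
  (TensorProduct.assoc ℂ (Weyl d μ) (Specht μ) E).toLinearMap ∘ₗ
    LinearMap.rTensor E (LinearMap.adjoint (embed d μ))

/-- An operator on `W_μ ⊗ V_μ ⊗ E`, as an operator on `(ℂ^d)^{⊗t} ⊗ E` that vanishes off the block
`P_μ ⊗ E`. -/
def fromBlock (d : ℕ) {t : ℕ} (μ : t.Partition)
    (Y : Weyl d μ ⊗[ℂ] (Specht μ ⊗[ℂ] E) →ₗ[ℂ] Weyl d μ ⊗[ℂ] (Specht μ ⊗[ℂ] E)) :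
    Tens d t ⊗[ℂ] E →ₗ[ℂ] Tens d t ⊗[ℂ] E :=
  embedE E d μ ∘ₗ Y ∘ₗ embedEAdj E d μ

/-- An operator on `(ℂ^d)^{⊗t} ⊗ E` (supported on the block `P_μ ⊗ E`), as an operator on
`W_μ ⊗ V_μ ⊗ E`. -/
def toBlock (d : ℕ) {t : ℕ} (μ : t.Partition) (X : Tens d t ⊗[ℂ] E →ₗ[ℂ] Tens d t ⊗[ℂ] E) :
    Weyl d μ ⊗[ℂ] (Specht μ ⊗[ℂ] E) →ₗ[ℂ] Weyl d μ ⊗[ℂ] (Specht μ ⊗[ℂ] E) :=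
  embedEAdj E d μ ∘ₗ X ∘ₗ embedE E d μ

/-- `Tr_{W_μ}[1_{P_μ} X 1_{P_μ}]`, an operator on `V_μ ⊗ E`. -/
def blockTrace (d : ℕ) {t : ℕ} (μ : t.Partition) (X : Tens d t ⊗[ℂ] E →ₗ[ℂ] Tens d t ⊗[ℂ] E) :
    Specht μ ⊗[ℂ] E →ₗ[ℂ] Specht μ ⊗[ℂ] E :=
  partialTrace (Weyl d μ) (Specht μ ⊗[ℂ] E)
    (toBlock E d μ
      (LinearMap.rTensor E (blockProj d μ) ∘ₗ X ∘ₗ LinearMap.rTensor E (blockProj d μ)))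

/-- The `t`-wise twirl `𝔼_R (R^{⊗t})_A X (R^{⊗t})_A†` on `A = (ℂ^d)^{⊗t}` of a random matrix `R`
distributed as `R ω` for a uniformly random `ω : Ω`. -/
def twirl {Ω : Type*} [Fintype Ω] {d : ℕ} (t : ℕ) (R : Ω → Matrix (Fin d) (Fin d) ℂ)
    (X : Tens d t ⊗[ℂ] E →ₗ[ℂ] Tens d t ⊗[ℂ] E) : Tens d t ⊗[ℂ] E →ₗ[ℂ] Tens d t ⊗[ℂ] E :=
  (Fintype.card Ω : ℂ)⁻¹ • ∑ ω, LinearMap.rTensor E (tensPow t (R ω)) ∘ₗ X ∘ₗ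
    LinearMap.adjoint (LinearMap.rTensor E (tensPow t (R ω)))

/-- The `t`-wise permutation-phase twirl: `R = PF` with `P` and `F` independent and uniform. -/
def pfTwirl (d t : ℕ) (X : Tens d t ⊗[ℂ] E →ₗ[ℂ] Tens d t ⊗[ℂ] E) :
    Tens d t ⊗[ℂ] E →ₗ[ℂ] Tens d t ⊗[ℂ] E :=
  twirl E t (Ω := Equiv.Perm (Fin d) × (Fin d → Fin 2))
    (fun ω => Matrix.of (fun y x => if y = ω.1 x then (1 : ℂ) else 0) *
      Matrix.diagonal (fun x => (-1 : ℂ) ^ (ω.2 x : ℕ))) X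

end Composite

end SchurWeyl

end

/-! The proof combines a computation of the twirl on matrix units with the representation theory of
S_t. Let N be the number of tuples with distinct entries.

For distinct tuples x and y, the random signs annihilate |x⟩⟨y| unless x and y have the same set of
entries, that is, y = x∘τ⁻¹ for a unique τ. In that case averaging over S_d replaces x by a
uniformly random distinct tuple and produces N⁻¹ Λ R_{τ⁻¹}. By linearity, every X = ΛSΛ is twirled
to N⁻¹ ∑_τ Tr(R_τ X) Λ R_{τ⁻¹} (`pfTwirlTens_distinct`). On the block μ, the operator Λ R_{τ⁻¹} is
Λ^{(μ)} ⊗ R^{(μ)}_{τ⁻¹}, and Tr(R_τ X) is the sum over ν of Tr(R^{(ν)}_τ Y_ν), with Y_ν the partial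
trace of X over W_ν. Schur orthogonality (`sum_trace_smul_spechtAct`) collapses the sum over τ to
(t!/dim V_μ) Y_μ. The constants match because Tr Λ^{(μ)} = N dim V_μ / t! (`trace_weylDistinct`),
which follows from Tr(Λ R_τ) = N δ_{τ,1} and orthogonality of characters.

The block decomposition needs the Specht modules to be the complete list of irreducibles of S_t.
Irreducibility is James' submodule theorem. Inequivalence holds because an intertwiner V_μ → V_ν
forces μ to dominate ν, and its adjoint forces the converse. Completeness is a count: the characters
are independent, and there are as many of them as cycle types, so some combination of them is the
indicator of the identity permutation. Applied to a vector of A, this combination writes it as a sum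
of vectors in the blocks (`iSup_blockSpace`). Isometry and orthogonality of the embeddings are
Schur's lemma for f†g. -/

namespace SchurWeyl

/-! ### Column-injective fillings -/

section Fillings

variable {K : Type*} [Fintype K] {r s c : K → ℕ}

/-- In a filling `r` whose columns are initial segments, each column has at least as many entries
below any height as in any other filling that is injective on columns. -/
theorem card_column_lt_le (hdown : ∀ k i, i ≤ r k → ∃ k', r k' = i ∧ c k' = c k)
    (hs : ∀ a b, c a = c b → s a = s b → a = b) (c₀ i₀ : ℕ) :
    (Finset.univ.filter fun k => c k = c₀ ∧ s k < i₀).card ≤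
      (Finset.univ.filter fun k => c k = c₀ ∧ r k < i₀).card := by
  classical
  -- If the column reaches height i₀, then r takes every value below i₀ on it, and injectivity
  -- limits s to i₀ such entries. Otherwise every entry of the column is counted for r.
  by_cases h : ∃ k, c k = c₀ ∧ i₀ ≤ r k
  · obtain ⟨k, hk, hik⟩ := h
    have h1 : (Finset.univ.filter fun k => c k = c₀ ∧ s k < i₀).card ≤
        (Finset.range i₀).card := by
      refine Finset.card_le_card_of_injOn s (fun a ha => ?_) (fun a ha b hb hab => ?_)
      · simp at ha ⊢
        exact ha.2
      · simp at ha hb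
        exact hs a b (ha.1.trans hb.1.symm) hab
    refine h1.trans ?_
    refine Finset.card_le_card_of_surjOn r fun i hi => ?_
    simp at hi
    obtain ⟨k', h1, h2⟩ := hdown k i (hi.le.trans hik)
    exact ⟨k', by simp [h1, h2, hk, hi], h1⟩
  · push Not at h
    refine Finset.card_le_card fun k hk => ?_
    simp at hk ⊢
    exact ⟨hk.1, h k hk.1⟩

theorem card_filter_lt_eq_sum_columns (u : K → ℕ) (i₀ : ℕ) :
    (Finset.univ.filter fun k => u k < i₀).card =
      ∑ c₀ ∈ Finset.univ.image c, (Finset.univ.filter fun k => c k = c₀ ∧ u k < i₀).card := by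
  classical
  rw [Finset.card_eq_sum_card_fiberwise (f := c) (t := Finset.univ.image c)
    (fun a _ => by simp)]
  refine Finset.sum_congr rfl fun c₀ _ => ?_
  rw [Finset.filter_filter]
  congr 1
  ext k
  simp [and_comm]

theorem card_lt_le_of_column_injective (hdown : ∀ k i, i ≤ r k → ∃ k', r k' = i ∧ c k' = c k)
    (hs : ∀ a b, c a = c b → s a = s b → a = b) (i₀ : ℕ) :
    (Finset.univ.filter fun k => s k < i₀).card ≤ (Finset.univ.filter fun k => r k < i₀).card := by
  rw [card_filter_lt_eq_sum_columns (c := c) s, card_filter_lt_eq_sum_columns (c := c) r]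
  exact Finset.sum_le_sum fun c₀ _ => card_column_lt_le hdown hs c₀ i₀

/-- A filling that is injective on columns and has the same content as `r` differs from `r` by a
permutation within columns. -/
theorem exists_column_perm (hdown : ∀ k i, i ≤ r k → ∃ k', r k' = i ∧ c k' = c k)
    (hs : ∀ a b, c a = c b → s a = s b → a = b)
    (hcard : ∀ i₀, (Finset.univ.filter fun k => s k < i₀).card =
      (Finset.univ.filter fun k => r k < i₀).card) :
    ∃ q : Equiv.Perm K, (∀ k, c (q k) = c k) ∧ ∀ k, r (q k) = s k := by
  classical
  have key : ∀ k, ∃ k', c k' = c k ∧ r k' = s k := by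
    intro k
    by_cases h : ∃ k'', c k'' = c k ∧ s k ≤ r k''
    · obtain ⟨k'', h1, h2⟩ := h
      obtain ⟨k', h3, h4⟩ := hdown k'' _ h2
      exact ⟨k', h4.trans h1, h3⟩
    -- Equality of the total counts forces equality in each column. But if r stays below s k
    -- throughout the column of k, then k itself is counted for r and not for s at height s k.
    · exfalso
      push Not at h
      have hsum := hcard (s k)
      rw [card_filter_lt_eq_sum_columns (c := c) s, card_filter_lt_eq_sum_columns (c := c) r,
        Finset.sum_eq_sum_iff_of_le fun c₀ _ => card_column_lt_le hdown hs c₀ (s k)] at hsum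
      have h1 := hsum (c k) (by simp)
      have h2 : (Finset.univ.filter fun a => c a = c k ∧ s a < s k) ⊂
          Finset.univ.filter fun a => c a = c k ∧ r a < s k := by
        refine (Finset.ssubset_iff_of_subset fun a ha => ?_).2 ⟨k, ?_, ?_⟩
        · simp at ha ⊢
          exact ⟨ha.1, h a ha.1⟩
        · simpa using h k rfl
        · simp
      exact (Finset.card_lt_card h2).ne h1
  choose q hq1 hq2 using key
  have hinj : Function.Injective q := fun a b hab =>
    hs a b (by rw [← hq1 a, ← hq1 b, hab]) (by rw [← hq2 a, ← hq2 b, hab])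
  exact ⟨Equiv.ofBijective q hinj.bijective_of_finite, hq1, hq2⟩

end Fillings

/-- Turns dominance in both directions into equality of shapes. Positivity matters because partial
sums do not see trailing zeros. -/
theorem list_eq_of_sum_take_eq {l l' : List ℕ} (hl : ∀ a ∈ l, 0 < a) (hl' : ∀ a ∈ l', 0 < a)
    (h : ∀ i, (l.take i).sum = (l'.take i).sum) : l = l' := by
  induction l generalizing l' with
  | nil =>
    cases l' with
    | nil => rfl
    | cons b l' =>
      have := h 1
      have := hl' b (by simp)
      simp at *
      omega
  | cons a l ih =>
    cases l' with
    | nil =>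
      have := h 1
      have := hl a (by simp)
      simp at *
      omega
    | cons b l' =>
      have hab : a = b := by simpa using h 1
      subst hab
      rw [ih (fun x hx => hl x (List.mem_cons_of_mem a hx))
        (fun x hx => hl' x (List.mem_cons_of_mem a hx)) fun i => by simpa using h (i + 1)]

/-! ### Tableaux -/

section Tableaux

variable {t : ℕ} {μ ν : t.Partition}

theorem rowLens_antitone {i j : Fin (rowLens μ).length} (h : i ≤ j) :
    (rowLens μ).get j ≤ (rowLens μ).get i := by
  rcases h.eq_or_lt with rfl | h
  · exact le_rfl
  · exact (List.pairwise_iff_get.1 (Multiset.pairwise_sort μ.parts (· ≥ ·))) i j h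

theorem rowLens_injective : Function.Injective (rowLens (t := t)) := by
  intro μ ν h
  ext1
  rw [← Multiset.sort_eq μ.parts (· ≥ ·), ← Multiset.sort_eq ν.parts (· ≥ ·)]
  exact congrArg _ h

theorem rowLens_pos : ∀ a ∈ rowLens μ, 0 < a := fun _ ha =>
  μ.parts_pos ((Multiset.mem_sort (· ≥ ·)).1 ha)

theorem card_cell : Fintype.card (Cell μ) = t := by
  have h : (rowLens μ).sum = t := by
    rw [← Multiset.sum_coe, rowLens, Multiset.sort_eq, μ.parts_sum]
  simp only [Fintype.card_sigma, Fintype.card_fin]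
  conv_rhs => rw [← h, ← List.ofFn_get (rowLens μ), List.sum_ofFn]

instance : Nonempty (Tableau μ) :=
  ⟨Fintype.equivOfCardEq (by rw [Fintype.card_fin, card_cell])⟩

/-- Two entries in the same box are equal. -/
theorem Tableau.eq_of_row_col (T : Tableau μ) {a b : Fin t} (hc : T.col a = T.col b)
    (hr : T.row a = T.row b) : a = b := by
  refine T.injective ?_
  have hr' : (T a).1 = (T b).1 := hr
  have hc' : ((T a).2 : ℕ) = (T b).2 := hc
  generalize T a = x at *
  generalize T b = y at *
  obtain ⟨i, x⟩ := x
  obtain ⟨j, y⟩ := y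
  obtain rfl : i = j := hr'
  congr 1
  exact Fin.ext hc'

/-- Row lengths decrease, so columns are initial segments; this is the hypothesis `hdown` of the
filling lemmas. -/
theorem Tableau.exists_above (T : Tableau μ) (k : Fin t) (i : ℕ) (hi : i ≤ (T.row k : ℕ)) :
    ∃ k', (T.row k' : ℕ) = i ∧ T.col k' = T.col k := by
  have hle : (⟨i, hi.trans_lt (T.row k).2⟩ : Fin (rowLens μ).length) ≤ T.row k := hi
  refine ⟨T.symm ⟨⟨i, hi.trans_lt (T.row k).2⟩, ⟨T.col k, ?_⟩⟩, ?_, ?_⟩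
  · exact (T k).2.2.trans_le (rowLens_antitone hle)
  · rw [Tableau.row, Equiv.apply_symm_apply]
  · rw [Tableau.col, Equiv.apply_symm_apply]

/-- A filling has content `μ` if the number of entries equal to `i` is the `i`-th part of `μ`. -/
def HasContent (μ : t.Partition) (s : Fin t → Fin (rowLens μ).length) : Prop :=
  ∀ i, (Finset.univ.filter fun k => s k = i).card = (rowLens μ).get i

theorem Tableau.hasContent_row (T : Tableau μ) : HasContent μ T.row := by
  intro i
  have h : (Finset.univ.filter fun k => T.row k = i).card =
      (Finset.univ.filter fun x : Cell μ => x.1 = i).card := by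
    refine Finset.card_bij (fun k _ => T k) (fun k hk => ?_) (fun a _ b _ h => T.injective h)
      (fun x hx => ⟨T.symm x, ?_, by simp⟩)
    · rw [Finset.mem_filter] at hk ⊢
      exact ⟨Finset.mem_univ _, hk.2⟩
    · rw [Finset.mem_filter] at hx ⊢
      exact ⟨Finset.mem_univ _, by simpa [Tableau.row] using hx.2⟩
  rw [h, ← Fintype.card_fin ((rowLens μ).get i), ← Finset.card_univ]
  refine (Finset.card_bij (fun j _ => (⟨i, j⟩ : Cell μ)) (by simp) (by simp) ?_).symm
  rintro ⟨i', j⟩ hx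
  obtain rfl : i' = i := by simpa using hx
  exact ⟨j, by simp, rfl⟩

theorem HasContent.comp_perm {s : Fin t → Fin (rowLens μ).length} (hs : HasContent μ s)
    (π : Equiv.Perm (Fin t)) : HasContent μ (s ∘ π) := by
  intro i
  rw [← hs i]
  exact Finset.card_bij (fun k _ => π k) (by simp) (by simp)
    (fun b hb => ⟨π.symm b, by simpa using hb, by simp⟩)

theorem HasContent.card_lt {s : Fin t → Fin (rowLens μ).length} (hs : HasContent μ s) (i₀ : ℕ) :
    (Finset.univ.filter fun k => (s k : ℕ) < i₀).card = ((rowLens μ).take i₀).sum := by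
  classical
  have h : ((rowLens μ).take i₀).sum =
      ∑ j with ((j : Fin (rowLens μ).length) : ℕ) < i₀, (rowLens μ).get j := by
    rw [← List.sum_take_ofFn, List.ofFn_get]
  rw [h, Finset.card_eq_sum_card_fiberwise (f := s)
      (t := Finset.univ.filter fun j : Fin (rowLens μ).length => (j : ℕ) < i₀)
      (fun a ha => by simpa using ha)]
  refine Finset.sum_congr rfl fun i hi => ?_
  rw [← hs i, Finset.filter_filter]
  congr 1
  ext k
  simp only [Finset.mem_filter, Finset.mem_univ, true_and] at hi ⊢
  constructor
  · exact fun h => h.2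
  · rintro rfl
    exact ⟨hi, rfl⟩

/-- The combinatorial source of dominance: injectivity on the columns of a diagram of shape μ leaves
at most as much room for the entries below i₀ as the first i₀ rows provide. -/
theorem sum_take_rowLens_le (T : Tableau μ) {s : Fin t → Fin (rowLens ν).length}
    (hs : HasContent ν s) (hinj : ∀ a b, T.col a = T.col b → s a = s b → a = b) (i₀ : ℕ) :
    ((rowLens ν).take i₀).sum ≤ ((rowLens μ).take i₀).sum := by
  rw [← hs.card_lt, ← T.hasContent_row.card_lt]
  exact card_lt_le_of_column_injective T.exists_above
    (fun a b hc h => hinj a b hc (Fin.ext h)) i₀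

theorem Tableau.exists_perm_of_hasContent (T : Tableau μ) {s : Fin t → Fin (rowLens μ).length}
    (hs : HasContent μ s) (hinj : ∀ a b, T.col a = T.col b → s a = s b → a = b) :
    ∃ q : Equiv.Perm (Fin t), (∀ k, T.col (q k) = T.col k) ∧ T.row ∘ q = s := by
  obtain ⟨q, h1, h2⟩ := exists_column_perm (r := fun k => (T.row k : ℕ)) T.exists_above
    (fun a b hc h => hinj a b hc (Fin.ext h))
    (fun i₀ => by rw [hs.card_lt, T.hasContent_row.card_lt])
  exact ⟨q, h1, funext fun k => Fin.ext (h2 k)⟩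

end Tableaux

/-! ### Column antisymmetrizers -/

section Antisymmetrizer

variable {n t : ℕ}

theorem permOp_one : permOp (n := n) (1 : Equiv.Perm (Fin t)) = LinearMap.id := rfl

theorem inner_permOp_left (π : Equiv.Perm (Fin t)) (u v : Tens n t) :
    inner ℂ (permOp π u) v = inner ℂ u (permOp π⁻¹ v) := by
  simp only [PiLp.inner_apply]
  refine Fintype.sum_equiv (π.arrowCongr (Equiv.refl (Fin n))).symm _ _ fun b => ?_
  change inner ℂ (u (b ∘ π)) (v b) = inner ℂ (u _) (v (_ ∘ ⇑π⁻¹))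
  have h : ((π.arrowCongr (Equiv.refl (Fin n))).symm b) ∘ ⇑π⁻¹ = b := by
    funext i
    simp [Equiv.arrowCongr]
  rw [h]
  rfl

theorem adjoint_permOp (π : Equiv.Perm (Fin t)) :
    LinearMap.adjoint (permOp (n := n) π) = permOp π⁻¹ := by
  symm
  rw [LinearMap.eq_adjoint_iff]
  intro x y
  rw [inner_permOp_left, inv_inv]

open scoped Classical in
/-- The sum `∑_q sign(q) R_q` over the permutations `q` that preserve the columns `c`. -/
def antisymmetrizer (n : ℕ) (c : Fin t → ℕ) : Tens n t →ₗ[ℂ] Tens n t :=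
  ∑ q : Equiv.Perm (Fin t) with ∀ k, c (q k) = c k, ((Equiv.Perm.sign q : ℤ) : ℂ) • permOp q

variable (c : Fin t → ℕ)

/-- Reindexing by q ↦ q p absorbs p into the sum over the column group, at the cost of its sign. -/
theorem antisymmetrizer_permOp {p : Equiv.Perm (Fin t)} (hp : ∀ k, c (p k) = c k) (u : Tens n t) :
    antisymmetrizer n c (permOp p u) =
      ((Equiv.Perm.sign p : ℤ) : ℂ) • antisymmetrizer n c u := by
  classical
  simp only [antisymmetrizer, LinearMap.sum_apply, LinearMap.smul_apply, Finset.smul_sum]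
  refine Finset.sum_bij' (fun q _ => q * p) (fun q _ => q * p⁻¹) ?_ ?_ ?_ ?_ ?_
  · intro q hq
    simp at hq ⊢
    intro k
    rw [hq, hp]
  · intro q hq
    simp at hq ⊢
    intro k
    rw [hq]
    conv_rhs => rw [← Equiv.apply_symm_apply p k]
    exact (hp _).symm
  · simp
  · simp
  · intro q _
    rw [permOp_mul, smul_smul]
    congr 1
    rw [map_mul]
    rcases Int.units_eq_one_or (Equiv.Perm.sign p) with h | h <;> simp [h]

theorem inner_antisymmetrizer_left (u v : Tens n t) :
    inner ℂ (antisymmetrizer n c u) v = inner ℂ u (antisymmetrizer n c v) := by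
  classical
  simp only [antisymmetrizer, LinearMap.sum_apply, LinearMap.smul_apply, sum_inner, inner_sum]
  refine Finset.sum_bij' (fun q _ => q⁻¹) (fun q _ => q⁻¹) ?_ ?_ ?_ ?_ ?_
  · intro q hq
    simp at hq ⊢
    intro k
    conv_rhs => rw [← Equiv.apply_symm_apply q k]
    exact (hq _).symm
  · intro q hq
    simp at hq ⊢
    intro k
    conv_rhs => rw [← Equiv.apply_symm_apply q k]
    exact (hq _).symm
  · simp
  · simp
  · intro q _
    rw [inner_smul_left, inner_smul_right, inner_permOp_left, Equiv.Perm.sign_inv]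
    simp

/-- The transposition of a and b preserves columns, fixes the ket and has sign -1, so the image
equals its own negative. -/
theorem antisymmetrizer_ket_eq_zero {s : Fin t → Fin n} {a b : Fin t} (hab : a ≠ b)
    (hc : c a = c b) (hs : s a = s b) : antisymmetrizer n c (ket s) = 0 := by
  classical
  have hp : ∀ k, c (Equiv.swap a b k) = c k := fun k => by
    by_cases h1 : k = a
    · rw [h1, Equiv.swap_apply_left, hc]
    · by_cases h2 : k = b
      · rw [h2, Equiv.swap_apply_right, hc]
      · rw [Equiv.swap_apply_of_ne_of_ne h1 h2]
  have hk : permOp (Equiv.swap a b) (ket s) = ket s := by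
    rw [permOp_ket]
    congr 1
    funext k
    change s ((Equiv.swap a b)⁻¹ k) = s k
    rw [Equiv.swap_inv]
    by_cases h1 : k = a
    · rw [h1, Equiv.swap_apply_left, hs]
    · by_cases h2 : k = b
      · rw [h2, Equiv.swap_apply_right, hs]
      · rw [Equiv.swap_apply_of_ne_of_ne h1 h2]
  have h := antisymmetrizer_permOp c hp (ket s)
  rw [hk, Equiv.Perm.sign_swap hab] at h
  have h2 : antisymmetrizer n c (ket s) = -antisymmetrizer n c (ket s) := by simpa using h
  have h3 : (2 : ℂ) • antisymmetrizer n c (ket s) = 0 := by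
    rw [two_smul]
    nth_rewrite 1 [h2]
    exact neg_add_cancel _
  exact (smul_eq_zero.1 h3).resolve_left two_ne_zero

/-- The scalar m is the order of the column group: each of its elements contributes sign(q)² = 1. -/
theorem antisymmetrizer_antisymmetrizer (u : Tens n t) :
    ∃ m : ℂ, m ≠ 0 ∧ antisymmetrizer n c (antisymmetrizer n c u) = m • antisymmetrizer n c u := by
  classical
  refine ⟨(Finset.univ.filter fun q : Equiv.Perm (Fin t) => ∀ k, c (q k) = c k).card, ?_, ?_⟩
  · rw [Nat.cast_ne_zero, Finset.card_ne_zero]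
    exact ⟨1, by simp⟩
  · conv_lhs => enter [2]; rw [antisymmetrizer]
    rw [LinearMap.sum_apply, map_sum]
    rw [Finset.sum_congr rfl (g := fun _ => antisymmetrizer n c u), Finset.sum_const,
      Nat.cast_smul_eq_nsmul]
    intro q hq
    rw [LinearMap.smul_apply, map_smul, antisymmetrizer_permOp c (Finset.mem_filter.1 hq).2,
      smul_smul]
    rcases Int.units_eq_one_or (Equiv.Perm.sign q) with h | h <;> simp [h]

theorem eq_sum_smul_ket (u : Tens n t) : u = ∑ s, u s • ket s := by
  ext x
  simp [ket, Pi.single_apply]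

end Antisymmetrizer

/-! ### Irreducibility of the Specht modules -/

section Irreducible

variable {t : ℕ} {μ ν : t.Partition}

theorem polytabloid_eq_antisymmetrizer (T : Tableau μ) :
    polytabloid T = antisymmetrizer _ T.col (ket T.row) := by
  simp [polytabloid, antisymmetrizer, LinearMap.sum_apply]

/-- Only the identity preserves both the rows and the columns of T, so {T} occurs in its polytabloid
exactly once. -/
theorem inner_ket_polytabloid (T : Tableau μ) : inner ℂ (ket T.row) (polytabloid T) = 1 := by
  classical
  rw [polytabloid, inner_sum, Finset.sum_eq_single 1]
  · simp [permOp_one, ket]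
  · intro q hq hq1
    rw [permOp_ket, inner_smul_right]
    refine mul_eq_zero_of_right _ ?_
    rw [ket, EuclideanSpace.inner_single_left, ket, PiLp.single_apply, if_neg, mul_zero]
    intro h
    apply hq1
    ext k
    have h1 : T.row (q k) = T.row k := by
      have := congrFun h (q k)
      simpa using this
    rw [T.eq_of_row_col ((Finset.mem_filter.1 hq).2 k) h1, Equiv.Perm.one_apply]
  · simp

theorem polytabloid_ne_zero (T : Tableau μ) : polytabloid T ≠ 0 := by
  intro h
  simpa [h] using inner_ket_polytabloid T

theorem hasContent_of_apply_ne_zero {u : Tens (rowLens μ).length t} (hu : u ∈ spechtSubmodule μ)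
    {s : Fin t → Fin (rowLens μ).length} (hs : u s ≠ 0) : HasContent μ s := by
  classical
  unfold spechtSubmodule at hu
  by_contra hcon
  refine hs ?_
  clear hs
  induction hu using Submodule.span_induction with
  | mem v h =>
    obtain ⟨T, rfl⟩ := h
    simp only [polytabloid, WithLp.ofLp_sum, Finset.sum_apply]
    refine Finset.sum_eq_zero fun q _ => ?_
    rw [permOp_ket, PiLp.smul_apply, ket, PiLp.single_apply, if_neg, smul_zero]
    rintro rfl
    exact hcon (T.hasContent_row.comp_perm _)
  | zero => rfl
  | add v w _ _ hv hw => rw [PiLp.add_apply, hv, hw, add_zero]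
  | smul a v _ hv => rw [PiLp.smul_apply, hv, smul_zero]

/-- A basis vector in the support of u has content μ. Either it repeats an entry in a column of T
and is annihilated, or it is a column permutation of `T.row` and goes to plus or minus the
polytabloid. -/
theorem antisymmetrizer_mem_span_polytabloid (T : Tableau μ) {u : Tens (rowLens μ).length t}
    (hu : u ∈ spechtSubmodule μ) : ∃ a : ℂ, antisymmetrizer _ T.col u = a • polytabloid T := by
  rw [← exists_congr fun _ => eq_comm, ← Submodule.mem_span_singleton, eq_sum_smul_ket u, map_sum]
  refine Submodule.sum_mem _ fun s _ => ?_
  rw [map_smul]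
  by_cases h0 : u s = 0
  · rw [h0, zero_smul]
    exact zero_mem _
  refine Submodule.smul_mem _ _ ?_
  by_cases hinj : ∀ a b, T.col a = T.col b → s a = s b → a = b
  · obtain ⟨q, hq, rfl⟩ := T.exists_perm_of_hasContent (hasContent_of_apply_ne_zero hu h0) hinj
    have h1 : ket (T.row ∘ q) = permOp q⁻¹ (ket T.row) := by rw [permOp_ket, inv_inv]
    have hq' : ∀ k, T.col (q⁻¹ k) = T.col k := fun k => by
      conv_rhs => rw [← Equiv.apply_symm_apply q k]
      exact (hq _).symm
    rw [h1, antisymmetrizer_permOp _ hq', ← polytabloid_eq_antisymmetrizer]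
    exact Submodule.smul_mem _ _ (Submodule.mem_span_singleton_self _)
  · push Not at hinj
    obtain ⟨a, b, hc, hab, hne⟩ := hinj
    rw [antisymmetrizer_ket_eq_zero _ hne hc hab]
    exact zero_mem _

theorem exists_permOp_polytabloid (T T' : Tableau μ) :
    ∃ π : Equiv.Perm (Fin t), permOp π (polytabloid T) = polytabloid T' := by
  refine ⟨(T'.trans T.symm)⁻¹, ?_⟩
  rw [permOp_polytabloid]
  congr 1
  ext1 k
  simp

/-- James' submodule theorem: an invariant subspace of the Specht module is trivial. -/
theorem eq_zero_or_spechtSubmodule_le {U : Submodule ℂ (Tens (rowLens μ).length t)}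
    (hU : U ≤ spechtSubmodule μ) (hinv : ∀ π : Equiv.Perm (Fin t), ∀ v ∈ U, permOp π v ∈ U) :
    U = ⊥ ∨ spechtSubmodule μ ≤ U := by
  -- If some antisymmetrizer is nonzero on U, then U contains a polytabloid and hence all of its
  -- translates. Otherwise self-adjointness of the antisymmetrizers makes U orthogonal to every
  -- polytabloid, hence to itself.
  by_cases h : ∃ (T : Tableau μ) (u : _), u ∈ U ∧ antisymmetrizer _ T.col u ≠ 0
  · right
    obtain ⟨T, u, hu, hne⟩ := h
    have hmem : antisymmetrizer _ T.col u ∈ U := by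
      simp only [antisymmetrizer, LinearMap.sum_apply, LinearMap.smul_apply]
      exact Submodule.sum_mem _ fun q _ => Submodule.smul_mem _ _ (hinv q u hu)
    obtain ⟨a, ha⟩ := antisymmetrizer_mem_span_polytabloid T (hU hu)
    have ha0 : a ≠ 0 := by
      rintro rfl
      exact hne (by rw [ha, zero_smul])
    have hT : polytabloid T ∈ U := by
      rw [ha] at hmem
      exact (Submodule.smul_mem_iff _ ha0).1 hmem
    rw [spechtSubmodule, Submodule.span_le]
    rintro _ ⟨T', rfl⟩
    obtain ⟨π, hπ⟩ := exists_permOp_polytabloid T T'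
    rw [← hπ]
    exact hinv π _ hT
  · left
    push Not at h
    rw [eq_bot_iff]
    intro u hu
    have horth : ∀ v ∈ spechtSubmodule μ, inner ℂ u v = 0 := by
      intro v hv
      unfold spechtSubmodule at hv
      induction hv using Submodule.span_induction with
      | mem v hv =>
        obtain ⟨T, rfl⟩ := hv
        rw [polytabloid_eq_antisymmetrizer, ← inner_antisymmetrizer_left, h T u hu,
          inner_zero_left]
      | zero => simp
      | add v w _ _ hv hw => rw [inner_add_right, hv, hw, add_zero]
      | smul a v _ hv => rw [inner_smul_right, hv, mul_zero]
    simpa using horth u (hU hu)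

theorem incl_spechtAct (π : Equiv.Perm (Fin t)) (v : Specht μ) :
    Specht.incl μ (spechtAct μ π v) = permOp π (Specht.incl μ v) := rfl

theorem incl_mem (v : Specht μ) : Specht.incl μ v ∈ spechtSubmodule μ := Subtype.prop v

theorem exists_incl_eq {u : Tens (rowLens μ).length t} (hu : u ∈ spechtSubmodule μ) :
    ∃ v : Specht μ, Specht.incl μ v = u := ⟨⟨u, hu⟩, rfl⟩

theorem specht_eq_bot_or_eq_top (U : Submodule ℂ (Specht μ))
    (hinv : ∀ π : Equiv.Perm (Fin t), ∀ v ∈ U, spechtAct μ π v ∈ U) : U = ⊥ ∨ U = ⊤ := by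
  have h := eq_zero_or_spechtSubmodule_le (μ := μ) (U := U.map (Specht.incl μ).toLinearMap) (by
    rintro _ ⟨v, _, rfl⟩
    exact incl_mem v) (by
    rintro π _ ⟨v, hv, rfl⟩
    exact ⟨_, hinv π v hv, rfl⟩)
  rcases h with h | h
  · left
    rw [eq_bot_iff]
    intro v hv
    have hv' : Specht.incl μ v ∈ U.map (Specht.incl μ).toLinearMap := ⟨v, hv, rfl⟩
    rw [h, Submodule.mem_bot] at hv'
    exact (Specht.incl μ).injective (hv'.trans (map_zero _).symm)
  · right
    rw [eq_top_iff]
    intro v _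
    obtain ⟨w, hw, hwv⟩ := h (incl_mem v)
    rwa [← (Specht.incl μ).injective hwv]

instance spechtNontrivial : Nontrivial (Specht μ) := by
  obtain ⟨T⟩ := (inferInstance : Nonempty (Tableau μ))
  refine ⟨⟨⟨polytabloid T, Submodule.subset_span ⟨T, rfl⟩⟩, 0, fun h => ?_⟩⟩
  exact polytabloid_ne_zero T (congrArg (Specht.incl μ) h)

/-- A polytabloid e of T is an eigenvector of its column antisymmetrizer with nonzero eigenvalue,
and f e ≠ 0 by irreducibility, so the antisymmetrizer does not annihilate f e. Some basis vector in
the support of f e therefore survives; it has content ν and is injective on the columns of T. -/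
theorem sum_take_rowLens_le_of_intertwiner {f : Specht μ →ₗ[ℂ] Specht ν} (hf : f ≠ 0)
    (hcomm : ∀ π, spechtAct ν π ∘ₗ f = f ∘ₗ spechtAct μ π) (i₀ : ℕ) :
    ((rowLens ν).take i₀).sum ≤ ((rowLens μ).take i₀).sum := by
  classical
  have hcomm' : ∀ π v, permOp π (Specht.incl ν (f v)) = Specht.incl ν (f (spechtAct μ π v)) :=
    fun π v => congrArg (Specht.incl ν) (LinearMap.congr_fun (hcomm π) v)
  obtain ⟨T⟩ := (inferInstance : Nonempty (Tableau μ))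
  obtain ⟨e, he⟩ := exists_incl_eq (μ := μ) (Submodule.subset_span ⟨T, rfl⟩ :
    polytabloid T ∈ spechtSubmodule μ)
  have hanti : ∀ v w : Specht μ, antisymmetrizer _ T.col (Specht.incl μ v) = Specht.incl μ w →
      antisymmetrizer _ T.col (Specht.incl ν (f v)) = Specht.incl ν (f w) := by
    intro v w hvw
    have hw : w = ∑ q : Equiv.Perm (Fin t) with ∀ k, T.col (q k) = T.col k,
        ((Equiv.Perm.sign q : ℤ) : ℂ) • spechtAct μ q v := by
      apply (Specht.incl μ).injective
      rw [← hvw]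
      simp [antisymmetrizer, LinearMap.sum_apply, incl_spechtAct]
    rw [hw]
    simp [antisymmetrizer, LinearMap.sum_apply, hcomm']
  have hfe : f e ≠ 0 := by
    intro h0
    have hker := specht_eq_bot_or_eq_top (LinearMap.ker f) (fun π v hv => by
      rw [LinearMap.mem_ker] at hv ⊢
      have := LinearMap.congr_fun (hcomm π) v
      simpa [hv] using this.symm)
    rcases hker with h | h
    · have : e ∈ LinearMap.ker f := h0
      rw [h, Submodule.mem_bot] at this
      rw [this, map_zero] at he
      exact polytabloid_ne_zero T he.symm
    · exact hf (LinearMap.ker_eq_top.1 h)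
  obtain ⟨m, hm, hmm⟩ := antisymmetrizer_antisymmetrizer T.col (ket T.row)
  rw [← polytabloid_eq_antisymmetrizer, ← he, ← map_smul] at hmm
  have h1 := hanti e (m • e) hmm
  have hne : antisymmetrizer _ T.col (Specht.incl ν (f e)) ≠ 0 := by
    rw [h1, map_smul, map_smul]
    refine smul_ne_zero hm fun h => hfe ((Specht.incl ν).injective ?_)
    rw [h, map_zero]
  rw [eq_sum_smul_ket (Specht.incl ν (f e)), map_sum] at hne
  obtain ⟨s, _, hs⟩ := Finset.exists_ne_zero_of_sum_ne_zero hne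
  rw [map_smul] at hs
  refine sum_take_rowLens_le T
    (hasContent_of_apply_ne_zero (incl_mem (f e)) (left_ne_zero_of_smul hs)) ?_ i₀
  intro a b hc hab
  by_contra hne
  exact right_ne_zero_of_smul hs (antisymmetrizer_ket_eq_zero _ hne hc hab)

/-- The inner product of the Specht module as a Hilbert space. -/
noncomputable instance spechtInner : Inner ℂ (Specht μ) := InnerProductSpace.toInner

theorem inner_spechtAct_left (π : Equiv.Perm (Fin t)) (v w : Specht μ) :
    inner ℂ (spechtAct μ π v) w = inner ℂ v (spechtAct μ π⁻¹ w) := by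
  exact inner_permOp_left π (Specht.incl μ v) (Specht.incl μ w)

theorem adjoint_spechtAct (π : Equiv.Perm (Fin t)) :
    LinearMap.adjoint (spechtAct μ π) = spechtAct μ π⁻¹ := by
  symm
  rw [LinearMap.eq_adjoint_iff]
  intro x y
  rw [inner_spechtAct_left, inv_inv]

/-- Specht modules of different shapes admit no nonzero intertwiners. -/
theorem intertwiner_eq_zero (hμν : μ ≠ ν) {f : Specht μ →ₗ[ℂ] Specht ν}
    (hcomm : ∀ π, spechtAct ν π ∘ₗ f = f ∘ₗ spechtAct μ π) : f = 0 := by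
  by_contra hf
  apply hμν
  apply rowLens_injective
  refine list_eq_of_sum_take_eq rowLens_pos rowLens_pos fun i => le_antisymm ?_ ?_
  -- As the actions are unitary, the adjoint of f intertwines in the opposite direction and gives
  -- the reverse dominance.
  · refine sum_take_rowLens_le_of_intertwiner (f := LinearMap.adjoint f) (by simpa using hf) ?_ i
    intro π
    have h := congrArg LinearMap.adjoint (hcomm π⁻¹)
    rw [LinearMap.adjoint_comp, LinearMap.adjoint_comp, adjoint_spechtAct, adjoint_spechtAct,
      inv_inv] at h
    exact h.symm
  · exact sum_take_rowLens_le_of_intertwiner hf hcomm i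

/-- Schur's lemma for the Specht modules. -/
theorem exists_eq_smul_id {f : Specht μ →ₗ[ℂ] Specht μ}
    (hcomm : ∀ π, spechtAct μ π ∘ₗ f = f ∘ₗ spechtAct μ π) : ∃ a : ℂ, f = a • LinearMap.id := by
  obtain ⟨a, ha⟩ := Module.End.exists_eigenvalue f
  refine ⟨a, ?_⟩
  have h := specht_eq_bot_or_eq_top (Module.End.eigenspace f a) (fun π v hv => by
    rw [Module.End.mem_eigenspace_iff] at hv ⊢
    have := LinearMap.congr_fun (hcomm π) v
    simp only [LinearMap.comp_apply] at this
    rw [← this, hv, map_smul])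
  rcases h with h | h
  · exact absurd h ha
  · ext v : 1
    have : v ∈ Module.End.eigenspace f a := h ▸ Submodule.mem_top
    simpa [Module.End.mem_eigenspace_iff] using this

end Irreducible

/-! ### Orthogonality relations -/

section Orthogonality

variable {d t : ℕ} {μ ν : t.Partition}

theorem spechtAct_mul (π τ : Equiv.Perm (Fin t)) :
    spechtAct μ (π * τ) = spechtAct μ π ∘ₗ spechtAct μ τ := rfl

theorem spechtAct_one : spechtAct μ 1 = LinearMap.id := rfl

theorem finrank_specht_ne_zero : (Module.finrank ℂ (Specht μ) : ℂ) ≠ 0 :=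
  Nat.cast_ne_zero.2 Module.finrank_pos.ne'

theorem eq_sum_smulRight {M N : Type*} [AddCommGroup M] [Module ℂ M] [FiniteDimensional ℂ M]
    [AddCommGroup N] [Module ℂ N] (Y : M →ₗ[ℂ] N) :
    Y = ∑ i, ((Module.finBasis ℂ M).coord i).smulRight (Y (Module.finBasis ℂ M i)) := by
  refine (Module.finBasis ℂ M).ext fun j => ?_
  simp [LinearMap.sum_apply, Finsupp.single_apply, ite_smul]

theorem spechtAct_comp_sum (T : Specht ν →ₗ[ℂ] Specht μ) (π : Equiv.Perm (Fin t)) :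
    spechtAct μ π ∘ₗ (∑ τ, spechtAct μ τ⁻¹ ∘ₗ T ∘ₗ spechtAct ν τ) =
      (∑ τ, spechtAct μ τ⁻¹ ∘ₗ T ∘ₗ spechtAct ν τ) ∘ₗ spechtAct ν π := by
  ext v : 1
  simp only [LinearMap.comp_apply, LinearMap.sum_apply, map_sum]
  refine Fintype.sum_equiv (Equiv.mulRight π⁻¹) _ _ fun τ => ?_
  simp only [Equiv.coe_mulRight, mul_inv_rev, inv_inv, LinearMap.comp_apply, spechtAct_mul]
  rw [← LinearMap.comp_apply (spechtAct ν π⁻¹), ← spechtAct_mul π⁻¹ π, inv_mul_cancel,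
    spechtAct_one, LinearMap.id_apply]

/-- Averaging an arbitrary linear map over the group yields an intertwiner; here this manufactures
elements of the Weyl module. -/
theorem permOp_comp_sum (T : Specht ν →ₗ[ℂ] Tens d t) (π : Equiv.Perm (Fin t)) :
    permOp π ∘ₗ (∑ τ, permOp τ⁻¹ ∘ₗ T ∘ₗ spechtAct ν τ) =
      (∑ τ, permOp τ⁻¹ ∘ₗ T ∘ₗ spechtAct ν τ) ∘ₗ spechtAct ν π := by
  ext v : 1
  simp only [LinearMap.comp_apply, LinearMap.sum_apply, map_sum]
  refine Fintype.sum_equiv (Equiv.mulRight π⁻¹) _ _ fun τ => ?_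
  simp only [Equiv.coe_mulRight, mul_inv_rev, inv_inv, LinearMap.comp_apply, permOp_mul,
    spechtAct_mul]
  rw [← LinearMap.comp_apply (spechtAct ν π⁻¹), ← spechtAct_mul π⁻¹ π, inv_mul_cancel,
    spechtAct_one, LinearMap.id_apply]

theorem sum_spechtAct_conj_of_ne (hμν : μ ≠ ν) (T : Specht ν →ₗ[ℂ] Specht μ) :
    ∑ τ, spechtAct μ τ⁻¹ ∘ₗ T ∘ₗ spechtAct ν τ = 0 :=
  intertwiner_eq_zero hμν.symm (spechtAct_comp_sum T)

/-- The average is scalar by Schur's lemma, and the scalar is read off from the trace: each of the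
t! summands has trace Tr T. -/
theorem sum_spechtAct_conj (T : Specht μ →ₗ[ℂ] Specht μ) :
    ∑ τ, spechtAct μ τ⁻¹ ∘ₗ T ∘ₗ spechtAct μ τ =
      ((t.factorial : ℂ) / Module.finrank ℂ (Specht μ) * LinearMap.trace ℂ _ T) •
        LinearMap.id := by
  obtain ⟨a, ha⟩ := exists_eq_smul_id (spechtAct_comp_sum T)
  have htr := congrArg (LinearMap.trace ℂ (Specht μ)) ha
  rw [map_sum, map_smul, LinearMap.trace_id, Finset.sum_congr rfl
    (g := fun _ => LinearMap.trace ℂ (Specht μ) T), Finset.sum_const, Finset.card_univ,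
    Fintype.card_perm, Fintype.card_fin, nsmul_eq_mul, smul_eq_mul] at htr
  · rw [ha]
    congr 1
    rw [div_mul_eq_mul_div, htr, mul_div_cancel_right₀ _ finrank_specht_ne_zero]
  · intro τ _
    rw [LinearMap.trace_comp_comm', LinearMap.comp_assoc, ← spechtAct_mul, mul_inv_cancel,
      spechtAct_one, LinearMap.comp_id]

theorem trace_spechtAct_comp (τ : Equiv.Perm (Fin t)) (Y : Specht ν →ₗ[ℂ] Specht ν) :
    LinearMap.trace ℂ _ (spechtAct ν τ ∘ₗ Y) = ∑ i, (Module.finBasis ℂ (Specht ν)).coord i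
      (spechtAct ν τ (Y (Module.finBasis ℂ (Specht ν) i))) := by
  conv_lhs => rw [eq_sum_smulRight (spechtAct ν τ ∘ₗ Y)]
  simp [map_sum, LinearMap.trace_smulRight]

theorem sum_trace_smul_spechtAct_of_ne (hμν : μ ≠ ν) (Y : Specht ν →ₗ[ℂ] Specht ν) :
    ∑ τ, LinearMap.trace ℂ _ (spechtAct ν τ ∘ₗ Y) • spechtAct μ τ⁻¹ = 0 := by
  ext u : 1
  simp only [LinearMap.sum_apply, LinearMap.smul_apply, trace_spechtAct_comp, Finset.sum_smul]
  rw [Finset.sum_comm]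
  refine Finset.sum_eq_zero fun i _ => ?_
  have h := LinearMap.congr_fun (sum_spechtAct_conj_of_ne hμν
    (((Module.finBasis ℂ (Specht ν)).coord i).smulRight u)) (Y (Module.finBasis ℂ (Specht ν) i))
  simpa [LinearMap.sum_apply] using h

/-- Fourier inversion on the group. Evaluated at u, with the trace expanded in a basis, it is the
averaging identity for the rank-one maps v ↦ (i-th coordinate of v) • u. -/
theorem sum_trace_smul_spechtAct (Y : Specht μ →ₗ[ℂ] Specht μ) :
    ∑ τ, LinearMap.trace ℂ _ (spechtAct μ τ ∘ₗ Y) • spechtAct μ τ⁻¹ =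
      ((t.factorial : ℂ) / Module.finrank ℂ (Specht μ)) • Y := by
  ext u : 1
  simp only [LinearMap.sum_apply, LinearMap.smul_apply, trace_spechtAct_comp, Finset.sum_smul]
  rw [Finset.sum_comm]
  conv_rhs => rw [eq_sum_smulRight Y, LinearMap.sum_apply, Finset.smul_sum]
  refine Finset.sum_congr rfl fun i _ => ?_
  have h := LinearMap.congr_fun (sum_spechtAct_conj
    (((Module.finBasis ℂ (Specht μ)).coord i).smulRight u)) (Y (Module.finBasis ℂ (Specht μ) i))
  rw [LinearMap.trace_smulRight] at h
  simpa [LinearMap.sum_apply, smul_smul] using h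

/-- The character of the Specht module. -/
noncomputable def spechtChar (μ : t.Partition) (τ : Equiv.Perm (Fin t)) : ℂ :=
  LinearMap.trace ℂ _ (spechtAct μ τ)

open scoped Classical in
theorem sum_spechtChar_mul (μ ν : t.Partition) :
    ∑ τ, spechtChar ν τ * spechtChar μ τ⁻¹ = if μ = ν then (t.factorial : ℂ) else 0 := by
  split_ifs with h
  · subst h
    have h1 := congrArg (LinearMap.trace ℂ _) (sum_trace_smul_spechtAct (μ := μ) LinearMap.id)
    simpa [map_sum, div_mul_cancel₀ _ (finrank_specht_ne_zero (μ := μ)), spechtChar] using h1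
  · have h1 := congrArg (LinearMap.trace ℂ _)
      (sum_trace_smul_spechtAct_of_ne (μ := μ) h LinearMap.id)
    simpa [map_sum, spechtChar] using h1

theorem linearIndependent_spechtChar : LinearIndependent ℂ (spechtChar (t := t)) := by
  classical
  rw [Fintype.linearIndependent_iff]
  intro g hg μ
  have h : ∑ τ, (∑ ν, g ν • spechtChar ν) τ * spechtChar μ τ⁻¹ = g μ * t.factorial := by
    simp only [Finset.sum_apply, Pi.smul_apply, smul_eq_mul, Finset.sum_mul]
    rw [Finset.sum_comm]
    simp only [mul_assoc, ← Finset.mul_sum, sum_spechtChar_mul]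
    simp
  rw [hg] at h
  simp only [Pi.zero_apply, zero_mul, Finset.sum_const_zero] at h
  exact (mul_eq_zero.1 h.symm).resolve_right (Nat.cast_ne_zero.2 t.factorial_ne_zero)

theorem spechtChar_conj (τ π : Equiv.Perm (Fin t)) :
    spechtChar μ (π * τ * π⁻¹) = spechtChar μ τ := by
  rw [spechtChar, spechtAct_mul, LinearMap.trace_comp_comm', ← spechtAct_mul, ← mul_assoc,
    inv_mul_cancel, one_mul, spechtChar]

/-- As there are as many Specht modules as conjugacy classes, their characters span the class
functions. -/
theorem exists_sum_spechtChar_eq (t : ℕ) : ∃ c : t.Partition → ℂ, ∀ τ,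
    ∑ μ, c μ * spechtChar μ τ = if τ = 1 then 1 else 0 := by
  classical
  let part : Equiv.Perm (Fin t) → (Fintype.card (Fin t)).Partition := fun τ => τ.partition
  have hfac : ∀ μ : t.Partition, ∃ ψ : (Fintype.card (Fin t)).Partition → ℂ,
      ∀ τ, ψ (part τ) = spechtChar μ τ := by
    intro μ
    have h : (spechtChar μ).FactorsThrough part := by
      intro σ τ h
      obtain ⟨π, hπ⟩ := isConj_iff.1 (Equiv.Perm.partition_eq_of_isConj.2 h)
      rw [← hπ, spechtChar_conj]
    -- The default value 0 is harmless: only the values at actual cycle types are used.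
    exact ⟨Function.extend part (spechtChar μ) 0, fun τ => h.extend_apply _ τ⟩
  choose ψ hψ using hfac
  have hli : LinearIndependent ℂ ψ := by
    refine LinearIndependent.of_comp (LinearMap.funLeft ℂ ℂ part) ?_
    convert linearIndependent_spechtChar (t := t) using 1
    funext μ τ
    exact hψ μ τ
  have hcard : Fintype.card t.Partition =
      Module.finrank ℂ ((Fintype.card (Fin t)).Partition → ℂ) := by
    rw [Module.finrank_fintype_fun_eq_card, Fintype.card_fin]
  have hspan := hli.span_eq_top_of_card_eq_finrank' hcard
  -- Only the identity has the cycle type of the identity, so this function pulls back to the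
  -- indicator of 1.
  have hmem : (fun p => if p = part 1 then (1 : ℂ) else 0) ∈ Submodule.span ℂ (Set.range ψ) :=
    hspan ▸ Submodule.mem_top
  obtain ⟨c, hc⟩ := (Submodule.mem_span_range_iff_exists_fun ℂ).1 hmem
  refine ⟨c, fun τ => ?_⟩
  have h := congrFun hc (part τ)
  simp only [Finset.sum_apply, Pi.smul_apply, hψ, smul_eq_mul] at h
  rw [h]
  congr 1
  rw [eq_iff_iff]
  refine ⟨fun h => ?_, fun h => h ▸ rfl⟩
  exact isConj_one_left.1 (Equiv.Perm.partition_eq_of_isConj.2 h)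

end Orthogonality

/-! ### The Schur-Weyl decomposition -/

section Decomposition

variable {d t : ℕ} {μ ν : t.Partition}

/-- The inner product of the Weyl module as a Hilbert space. -/
noncomputable instance weylInner : Inner ℂ (Weyl d μ) := InnerProductSpace.toInner

theorem permOp_toHom (f : Weyl d μ) (π : Equiv.Perm (Fin t)) (v : Specht μ) :
    permOp π (Weyl.toHom d μ f v) = Weyl.toHom d μ f (spechtAct μ π v) :=
  LinearMap.congr_fun (Subtype.prop f π) v

theorem permOp_comp_toHom (f : Weyl d μ) (π : Equiv.Perm (Fin t)) :
    permOp π ∘ₗ Weyl.toHom d μ f = Weyl.toHom d μ f ∘ₗ spechtAct μ π := Subtype.prop f π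

theorem spechtAct_comp_adjoint_comp (f : Weyl d μ) (g : Weyl d ν) (π : Equiv.Perm (Fin t)) :
    spechtAct μ π ∘ₗ (LinearMap.adjoint (Weyl.toHom d μ f) ∘ₗ Weyl.toHom d ν g) =
      (LinearMap.adjoint (Weyl.toHom d μ f) ∘ₗ Weyl.toHom d ν g) ∘ₗ spechtAct ν π := by
  have h := congrArg LinearMap.adjoint (permOp_comp_toHom f π⁻¹)
  rw [LinearMap.adjoint_comp, LinearMap.adjoint_comp, adjoint_spechtAct, adjoint_permOp,
    inv_inv] at h
  rw [← LinearMap.comp_assoc, ← h, LinearMap.comp_assoc, permOp_comp_toHom, LinearMap.comp_assoc]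

theorem adjoint_toHom_comp_toHom_of_ne (hμν : μ ≠ ν) (f : Weyl d μ) (g : Weyl d ν) :
    LinearMap.adjoint (Weyl.toHom d μ f) ∘ₗ Weyl.toHom d ν g = 0 :=
  intertwiner_eq_zero hμν.symm (spechtAct_comp_adjoint_comp f g)

/-- Schur's lemma makes f†g a scalar; the factor 1/dim V_μ in the inner product of W_μ makes that
scalar ⟨f, g⟩. -/
theorem adjoint_toHom_comp_toHom (f g : Weyl d μ) :
    LinearMap.adjoint (Weyl.toHom d μ f) ∘ₗ Weyl.toHom d μ g =
      (inner ℂ f g : ℂ) • LinearMap.id := by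
  obtain ⟨a, ha⟩ := exists_eq_smul_id (spechtAct_comp_adjoint_comp f g)
  have h : inner ℂ f g = a := by
    refine (Weyl.inner_def d μ f g).trans ?_
    rw [ha, map_smul, LinearMap.trace_id, smul_eq_mul, mul_comm, mul_assoc,
      mul_inv_cancel₀ finrank_specht_ne_zero, mul_one]
  rw [ha, h]

theorem inner_toHom_toHom (f g : Weyl d μ) (v w : Specht μ) :
    inner ℂ (Weyl.toHom d μ f v) (Weyl.toHom d μ g w) = inner ℂ f g * inner ℂ v w := by
  rw [← LinearMap.adjoint_inner_right, ← LinearMap.comp_apply, adjoint_toHom_comp_toHom,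
    LinearMap.smul_apply, LinearMap.id_apply, inner_smul_right]

theorem inner_toHom_toHom_of_ne (hμν : μ ≠ ν) (f : Weyl d μ) (g : Weyl d ν) (v : Specht μ)
    (w : Specht ν) : inner ℂ (Weyl.toHom d μ f v) (Weyl.toHom d ν g w) = 0 := by
  rw [← LinearMap.adjoint_inner_right, ← LinearMap.comp_apply,
    adjoint_toHom_comp_toHom_of_ne hμν, LinearMap.zero_apply, inner_zero_right]

theorem embed_tmul (f : Weyl d μ) (v : Specht μ) : embed d μ (f ⊗ₜ v) = Weyl.toHom d μ f v := rfl

theorem adjoint_embed_comp_embed (d : ℕ) (μ : t.Partition) :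
    LinearMap.adjoint (embed d μ) ∘ₗ embed d μ = LinearMap.id := by
  refine TensorProduct.ext' fun f v => ?_
  rw [TensorProduct.ext_iff_inner_right]
  intro g w
  rw [LinearMap.comp_apply, LinearMap.adjoint_inner_left, embed_tmul, embed_tmul,
    inner_toHom_toHom, LinearMap.id_apply, TensorProduct.inner_tmul]

theorem adjoint_embed_comp_embed_of_ne (d : ℕ) (hμν : μ ≠ ν) :
    LinearMap.adjoint (embed d μ) ∘ₗ embed d ν = 0 := by
  refine TensorProduct.ext' fun f v => ?_
  rw [TensorProduct.ext_iff_inner_right]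
  intro g w
  rw [LinearMap.comp_apply, LinearMap.adjoint_inner_left, embed_tmul, embed_tmul,
    inner_toHom_toHom_of_ne hμν.symm, LinearMap.zero_apply, inner_zero_left]

theorem norm_embed (x : Weyl d μ ⊗[ℂ] Specht μ) : ‖embed d μ x‖ = ‖x‖ := by
  rw [norm_eq_sqrt_re_inner (𝕜 := ℂ), norm_eq_sqrt_re_inner (𝕜 := ℂ),
    ← LinearMap.adjoint_inner_right, ← LinearMap.comp_apply, adjoint_embed_comp_embed,
    LinearMap.id_apply]

theorem blockSpace_isOrtho (d : ℕ) (hμν : μ ≠ ν) : blockSpace d μ ⟂ blockSpace d ν := by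
  rw [Submodule.isOrtho_iff_inner_eq]
  rintro _ ⟨x, rfl⟩ _ ⟨y, rfl⟩
  rw [← LinearMap.adjoint_inner_right, ← LinearMap.comp_apply,
    adjoint_embed_comp_embed_of_ne d hμν, LinearMap.zero_apply, inner_zero_right]

/-- With the character written as a sum of diagonal matrix coefficients, the i-th term is the value
at the i-th basis vector of the intertwiner obtained by averaging v ↦ (i-th coordinate of v) • q. -/
theorem sum_spechtChar_smul_permOp_mem (q : Tens d t) :
    ∑ τ, spechtChar ν τ • permOp τ⁻¹ q ∈ blockSpace d ν := by
  have h : ∀ τ, spechtChar ν τ = ∑ i, (Module.finBasis ℂ (Specht ν)).coord i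
      (spechtAct ν τ (Module.finBasis ℂ (Specht ν) i)) := fun τ =>
    trace_spechtAct_comp τ LinearMap.id
  simp only [h, Finset.sum_smul]
  rw [Finset.sum_comm]
  refine Submodule.sum_mem _ fun i _ => ?_
  let f : Weyl d ν := ⟨_, permOp_comp_sum
    (((Module.finBasis ℂ (Specht ν)).coord i).smulRight q)⟩
  refine ⟨f ⊗ₜ Module.finBasis ℂ (Specht ν) i, ?_⟩
  rw [embed_tmul]
  change (∑ τ, permOp τ⁻¹ ∘ₗ (((Module.finBasis ℂ (Specht ν)).coord i).smulRight q) ∘ₗ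
    spechtAct ν τ) _ = _
  simp [LinearMap.sum_apply]

theorem iSup_blockSpace (d t : ℕ) : ⨆ μ : t.Partition, blockSpace d μ = ⊤ := by
  rw [eq_top_iff]
  intro q _
  obtain ⟨c, hc⟩ := exists_sum_spechtChar_eq t
  have h : q = ∑ μ, c μ • ∑ τ, spechtChar μ τ • permOp τ⁻¹ q := by
    simp only [Finset.smul_sum, smul_smul]
    rw [Finset.sum_comm]
    simp only [← Finset.sum_smul, hc]
    simp [permOp_one]
  rw [h]
  exact Submodule.sum_mem _ fun μ _ => Submodule.smul_mem _ _
    (Submodule.mem_iSup_of_mem μ (sum_spechtChar_smul_permOp_mem q))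

theorem sum_embed_comp_adjoint (d t : ℕ) :
    ∑ μ : t.Partition, embed d μ ∘ₗ LinearMap.adjoint (embed d μ) = LinearMap.id := by
  classical
  rw [← LinearMap.eqLocus_eq_top, eq_top_iff, ← iSup_blockSpace, iSup_le_iff]
  rintro μ _ ⟨x, rfl⟩
  rw [LinearMap.mem_eqLocus, LinearMap.sum_apply, Finset.sum_eq_single μ]
  · rw [LinearMap.comp_apply, ← LinearMap.comp_apply (LinearMap.adjoint _),
      adjoint_embed_comp_embed]
    rfl
  · intro ν _ hν
    rw [LinearMap.comp_apply, ← LinearMap.comp_apply (LinearMap.adjoint _),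
      adjoint_embed_comp_embed_of_ne d hν, LinearMap.zero_apply, map_zero]
  · simp

end Decomposition

/-! ### The distinct subspace in the Schur-Weyl decomposition -/

section Distinct

variable {d t : ℕ}

open scoped Classical in
/-- The number of tuples with pairwise different entries. -/
def numDistinct (d t : ℕ) : ℕ := (Finset.univ.filter fun x : Fin t → Fin d => x.Injective).card

theorem inner_ket_ket (x y : Fin t → Fin d) :
    inner ℂ (ket x) (ket y) = if x = y then (1 : ℂ) else 0 := by
  rw [ket, EuclideanSpace.inner_single_left, ket, PiLp.single_apply]
  simp

theorem distinctProj_ket_of_injective {x : Fin t → Fin d} (hx : x.Injective) :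
    distinctProj d t (ket x) = ket x := by
  ext y
  rw [distinctProj_apply, ket, PiLp.single_apply]
  split_ifs with h1 h2 h2
  · rfl
  · rfl
  · exact absurd (h2 ▸ hx) h1
  · rfl

theorem distinctProj_ket_of_not_injective {x : Fin t → Fin d} (hx : ¬ x.Injective) :
    distinctProj d t (ket x) = 0 := by
  ext y
  rw [distinctProj_apply, ket, PiLp.single_apply]
  split_ifs with h1 h2
  · exact absurd (h2 ▸ h1) hx
  · rfl
  · rfl

theorem inner_distinctProj_left (u v : Tens d t) :
    inner ℂ (distinctProj d t u) v = inner ℂ u (distinctProj d t v) := by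
  classical
  simp only [PiLp.inner_apply]
  refine Finset.sum_congr rfl fun x _ => ?_
  rw [distinctProj_apply, distinctProj_apply]
  split_ifs <;> simp

theorem adjoint_distinctProj (d t : ℕ) :
    LinearMap.adjoint (distinctProj d t) = distinctProj d t :=
  ((LinearMap.eq_adjoint_iff _ _).2 inner_distinctProj_left).symm

theorem distinctProj_distinctProj (u : Tens d t) :
    distinctProj d t (distinctProj d t u) = distinctProj d t u := by
  classical
  ext x
  simp only [distinctProj_apply]
  split_ifs <;> rfl

theorem comp_rankOne_comp_adjoint {F G : Type*} [NormedAddCommGroup F] [InnerProductSpace ℂ F]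
    [FiniteDimensional ℂ F] [NormedAddCommGroup G] [InnerProductSpace ℂ G] [FiniteDimensional ℂ G]
    (A : F →ₗ[ℂ] G) (u v : F) :
    A ∘ₗ (InnerProductSpace.rankOne ℂ u v).toLinearMap ∘ₗ LinearMap.adjoint A =
      (InnerProductSpace.rankOne ℂ (A u) (A v)).toLinearMap := by
  ext z
  simp [LinearMap.adjoint_inner_right]

variable {μ : t.Partition}

theorem toHom_weylDistinct (f : Weyl d μ) :
    Weyl.toHom d μ (weylDistinct d μ f) = distinctProj d t ∘ₗ Weyl.toHom d μ f := rfl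

theorem toHom_injective : Function.Injective (Weyl.toHom d μ) := Subtype.val_injective

theorem weylDistinct_isSymmetricProjection (d : ℕ) (μ : t.Partition) :
    (weylDistinct d μ).IsSymmetricProjection where
  isIdempotentElem := by
    refine LinearMap.ext fun f => toHom_injective (LinearMap.ext fun v => ?_)
    exact distinctProj_distinctProj (Weyl.toHom d μ f v)
  isSymmetric f g := by
    refine (Weyl.inner_def d μ _ _).trans (Eq.trans ?_ (Weyl.inner_def d μ _ _).symm)
    rw [toHom_weylDistinct, toHom_weylDistinct, LinearMap.adjoint_comp, adjoint_distinctProj,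
      LinearMap.comp_assoc]

theorem distinctProj_comp_permOp_comp_embed (d : ℕ) (μ : t.Partition) (τ : Equiv.Perm (Fin t)) :
    (distinctProj d t ∘ₗ permOp τ) ∘ₗ embed d μ =
      embed d μ ∘ₗ TensorProduct.map (weylDistinct d μ) (spechtAct μ τ) := by
  refine TensorProduct.ext' fun f v => ?_
  simp only [LinearMap.comp_apply, TensorProduct.map_tmul, embed_tmul, permOp_toHom]
  rfl

theorem permOp_comp_embed (d : ℕ) (μ : t.Partition) (τ : Equiv.Perm (Fin t)) :
    permOp τ ∘ₗ embed d μ = embed d μ ∘ₗ TensorProduct.map LinearMap.id (spechtAct μ τ) := by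
  refine TensorProduct.ext' fun f v => ?_
  simp only [LinearMap.comp_apply, TensorProduct.map_tmul, embed_tmul, permOp_toHom]
  rfl

theorem eq_sum_comp_embed (A : Tens d t →ₗ[ℂ] Tens d t) :
    A = ∑ μ : t.Partition, (A ∘ₗ embed d μ) ∘ₗ LinearMap.adjoint (embed d μ) := by
  ext1 u
  have h := congrArg A (LinearMap.congr_fun (sum_embed_comp_adjoint d t) u)
  simpa [LinearMap.sum_apply, map_sum] using h.symm

theorem distinctProj_comp_permOp (d : ℕ) (τ : Equiv.Perm (Fin t)) :
    distinctProj d t ∘ₗ permOp τ = ∑ μ : t.Partition, embed d μ ∘ₗ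
      TensorProduct.map (weylDistinct d μ) (spechtAct μ τ) ∘ₗ
        LinearMap.adjoint (embed d μ) := by
  refine (eq_sum_comp_embed (distinctProj d t ∘ₗ permOp τ)).trans
    (Finset.sum_congr rfl fun μ _ => ?_)
  rw [distinctProj_comp_permOp_comp_embed, LinearMap.comp_assoc]

theorem distinctProj_eq_sum (d t : ℕ) :
    distinctProj d t = ∑ μ : t.Partition, embed d μ ∘ₗ
      TensorProduct.map (weylDistinct d μ) LinearMap.id ∘ₗ LinearMap.adjoint (embed d μ) :=
  distinctProj_comp_permOp d 1

/-- No permutation other than the identity fixes a tuple with distinct entries. -/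
theorem trace_distinctProj_comp_permOp (τ : Equiv.Perm (Fin t)) :
    LinearMap.trace ℂ _ (distinctProj d t ∘ₗ permOp τ) =
      if τ = 1 then (numDistinct d t : ℂ) else 0 := by
  classical
  rw [LinearMap.trace_eq_sum_inner _ (EuclideanSpace.basisFun (Fin t → Fin d) ℂ)]
  have h : ∀ x : Fin t → Fin d, inner ℂ (EuclideanSpace.basisFun (Fin t → Fin d) ℂ x)
      ((distinctProj d t ∘ₗ permOp τ) (EuclideanSpace.basisFun (Fin t → Fin d) ℂ x)) =
        if x.Injective then if τ = 1 then (1 : ℂ) else 0 else 0 := by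
    intro x
    have hx : EuclideanSpace.basisFun (Fin t → Fin d) ℂ x = ket x := by simp [ket]
    rw [hx, LinearMap.comp_apply, ← inner_distinctProj_left, permOp_ket]
    split_ifs with h1 h2
    · rw [distinctProj_ket_of_injective h1, inner_ket_ket, if_pos]
      rw [h2]
      rfl
    · rw [distinctProj_ket_of_injective h1, inner_ket_ket, if_neg]
      intro h
      apply h2
      ext k
      have := h1 (congrFun h (τ k))
      simp at this
      rw [this, Equiv.Perm.one_apply]
    · rw [distinctProj_ket_of_not_injective h1, inner_zero_left]
  simp only [h]
  rw [← Finset.sum_filter, Finset.sum_const, numDistinct]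
  split_ifs <;> simp

/-- The block form of Λ R_τ expands N δ_{τ,1} in characters, with coefficients Tr Λ^{(ν)};
orthogonality extracts the coefficient of μ. -/
theorem trace_weylDistinct (d : ℕ) (μ : t.Partition) :
    LinearMap.trace ℂ _ (weylDistinct d μ) =
      numDistinct d t * Module.finrank ℂ (Specht μ) / t.factorial := by
  classical
  have h1 : ∀ τ : Equiv.Perm (Fin t), (if τ = 1 then (numDistinct d t : ℂ) else 0) =
      ∑ ν : t.Partition, LinearMap.trace ℂ _ (weylDistinct d ν) * spechtChar ν τ⁻¹ := by
    intro τ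
    have h := trace_distinctProj_comp_permOp (d := d) τ⁻¹
    rw [distinctProj_comp_permOp, map_sum] at h
    simp only [inv_eq_one] at h
    rw [← h]
    refine Finset.sum_congr rfl fun ν _ => ?_
    rw [LinearMap.trace_comp_comm', LinearMap.comp_assoc, adjoint_embed_comp_embed,
      LinearMap.comp_id, LinearMap.trace_tensorProduct', spechtChar]
  have h2 : ∑ τ, spechtChar μ τ * (if τ = 1 then (numDistinct d t : ℂ) else 0) =
      LinearMap.trace ℂ _ (weylDistinct d μ) * t.factorial := by
    simp only [h1, Finset.mul_sum]
    rw [Finset.sum_comm]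
    simp only [mul_left_comm (spechtChar μ _), ← Finset.mul_sum, sum_spechtChar_mul]
    simp
  rw [eq_div_iff (Nat.cast_ne_zero.2 t.factorial_ne_zero), ← h2]
  simp [spechtChar, spechtAct_one, mul_comm]

end Distinct

/-! ### Partial traces -/

section PartialTrace

/-- Operators on a tensor product are sums of product operators. -/
theorem tensor_operator_induction {W X : Type*} [AddCommGroup W] [Module ℂ W]
    [FiniteDimensional ℂ W] [AddCommGroup X] [Module ℂ X] [FiniteDimensional ℂ X]
    {p : (W ⊗[ℂ] X →ₗ[ℂ] W ⊗[ℂ] X) → Prop} (hmap : ∀ S T, p (TensorProduct.map S T))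
    (hadd : ∀ Y Z, p Y → p Z → p (Y + Z)) (Z : W ⊗[ℂ] X →ₗ[ℂ] W ⊗[ℂ] X) : p Z := by
  obtain ⟨z, rfl⟩ := (homTensorHomEquiv ℂ W X W X).surjective Z
  induction z using TensorProduct.induction_on with
  | zero =>
    rw [map_zero, ← TensorProduct.map_zero_left (0 : X →ₗ[ℂ] X)]
    exact hmap 0 0
  | tmul S T =>
    rw [homTensorHomEquiv_apply, TensorProduct.homTensorHomMap_apply]
    exact hmap S T
  | add y z hy hz =>
    rw [map_add]
    exact hadd _ _ hy hz

/-- The duality that characterizes the partial trace; both sides are additive in Z, so product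
operators suffice. -/
theorem trace_map_id_comp {W X : Type*} [AddCommGroup W] [Module ℂ W]
    [FiniteDimensional ℂ W] [AddCommGroup X] [Module ℂ X] [FiniteDimensional ℂ X]
    (B : X →ₗ[ℂ] X) (Z : W ⊗[ℂ] X →ₗ[ℂ] W ⊗[ℂ] X) :
    LinearMap.trace ℂ _ (TensorProduct.map LinearMap.id B ∘ₗ Z) =
      LinearMap.trace ℂ _ (B ∘ₗ partialTrace W X Z) := by
  induction Z using tensor_operator_induction with
  | hmap S T =>
    rw [← TensorProduct.map_comp, LinearMap.trace_tensorProduct', LinearMap.id_comp,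
      partialTrace_map, LinearMap.comp_smul, map_smul, smul_eq_mul]
  | hadd Y Z hY hZ => rw [LinearMap.comp_add, map_add, hY, hZ, map_add, LinearMap.comp_add, map_add]

theorem partialTrace_assoc {W V E : Type*} [AddCommGroup W] [Module ℂ W]
    [FiniteDimensional ℂ W] [AddCommGroup V] [Module ℂ V] [FiniteDimensional ℂ V]
    [AddCommGroup E] [Module ℂ E] [FiniteDimensional ℂ E]
    (Z : W ⊗[ℂ] V →ₗ[ℂ] W ⊗[ℂ] V) (T : E →ₗ[ℂ] E) :
    partialTrace W (V ⊗[ℂ] E) ((TensorProduct.assoc ℂ W V E).toLinearMap ∘ₗ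
      TensorProduct.map Z T ∘ₗ (TensorProduct.assoc ℂ W V E).symm.toLinearMap) =
        TensorProduct.map (partialTrace W V Z) T := by
  induction Z using tensor_operator_induction with
  | hmap A B =>
    have h : (TensorProduct.assoc ℂ W V E).toLinearMap ∘ₗ
        TensorProduct.map (TensorProduct.map A B) T ∘ₗ
          (TensorProduct.assoc ℂ W V E).symm.toLinearMap =
        TensorProduct.map A (TensorProduct.map B T) := by
      ext w v e
      simp
    rw [h, partialTrace_map, partialTrace_map, TensorProduct.map_smul_left]
  | hadd Y Z hY hZ =>
    rw [TensorProduct.map_add_left, LinearMap.add_comp, LinearMap.comp_add, map_add, hY, hZ,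
      map_add, TensorProduct.map_add_left]

end PartialTrace

/-! ### The permutation-phase twirl of matrix units -/

section Twirl

variable {d t : ℕ}

/-- The product of a permutation matrix and a diagonal matrix of signs. -/
noncomputable def permPhase (ω : Equiv.Perm (Fin d) × (Fin d → Fin 2)) :
    Matrix (Fin d) (Fin d) ℂ :=
  Matrix.of (fun y x => if y = ω.1 x then (1 : ℂ) else 0) *
    Matrix.diagonal (fun x => (-1 : ℂ) ^ (ω.2 x : ℕ))

theorem tensPow_permPhase_ket (ω : Equiv.Perm (Fin d) × (Fin d → Fin 2)) (x : Fin t → Fin d) :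
    tensPow t (permPhase ω) (ket x) =
      (∏ i, (-1 : ℂ) ^ (ω.2 (x i) : ℕ)) • ket (ω.1 ∘ x) := by
  classical
  ext b
  have h : tensPow t (permPhase ω) (ket x) b = ∏ i, permPhase ω (b i) (x i) := by
    simp [tensPow, ket, Matrix.toLpLin_apply]
  rw [h, PiLp.smul_apply, ket, PiLp.single_apply]
  simp only [permPhase, Matrix.mul_diagonal, Matrix.of_apply, ite_mul, one_mul, zero_mul]
  rw [Finset.prod_ite_zero]
  simp [funext_iff]

/-- The sum over f factors over the points a of [d]. A point in exactly one of the two images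
contributes 1 + (-1) = 0; any other contributes 2, its signs being absent or squared. -/
theorem sum_phases (x y : Fin t → Fin d) (hx : x.Injective) (hy : y.Injective) :
    ∑ f : Fin d → Fin 2, (∏ i, (-1 : ℂ) ^ (f (x i) : ℕ)) * ∏ i, (-1 : ℂ) ^ (f (y i) : ℕ) =
      if Finset.univ.image x = Finset.univ.image y then 2 ^ d else 0 := by
  classical
  have hprod : ∀ (z : Fin t → Fin d), z.Injective → ∀ f : Fin d → Fin 2,
      ∏ i, (-1 : ℂ) ^ (f (z i) : ℕ) =
        ∏ a, if a ∈ Finset.univ.image z then (-1 : ℂ) ^ (f a : ℕ) else 1 := by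
    intro z hz f
    rw [Finset.prod_ite_mem, Finset.univ_inter, Finset.prod_image fun a _ b _ h => hz h]
  simp only [hprod x hx, hprod y hy, ← Finset.prod_mul_distrib]
  have h := Finset.prod_univ_sum (R := ℂ) (fun _ : Fin d => (Finset.univ : Finset (Fin 2)))
    (fun a b => (if a ∈ Finset.univ.image x then (-1 : ℂ) ^ (b : ℕ) else 1) *
      if a ∈ Finset.univ.image y then (-1 : ℂ) ^ (b : ℕ) else 1)
  rw [Fintype.piFinset_univ] at h
  rw [← h]
  split_ifs with hxy
  · rw [hxy, Finset.prod_congr rfl (g := fun _ => (2 : ℂ))]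
    · simp
    · intro a _
      rw [Fin.sum_univ_two]
      split_ifs <;> norm_num
  · obtain ⟨a, ha⟩ : ∃ a, ¬ (a ∈ Finset.univ.image x ↔ a ∈ Finset.univ.image y) := by
      by_contra hcon
      push Not at hcon
      exact hxy (Finset.ext hcon)
    refine Finset.prod_eq_zero (Finset.mem_univ a) ?_
    rw [Fin.sum_univ_two]
    split_ifs with h1 h2 h2
    · exact absurd (iff_of_true h1 h2) ha
    · norm_num
    · norm_num
    · exact absurd (iff_of_false h1 h2) ha

open scoped Classical in
/-- Averaging over the symmetric group is averaging over the tuples of distinct entries. -/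
theorem numDistinct_smul_sum_perm {M : Type*} [AddCommGroup M] [Module ℂ M]
    (G : (Fin t → Fin d) → M) {x : Fin t → Fin d} (hx : x.Injective) :
    (numDistinct d t : ℂ) • ∑ p : Equiv.Perm (Fin d), G (p ∘ x) =
      (d.factorial : ℂ) • ∑ z : Fin t → Fin d with z.Injective, G z := by
  -- The double sum of G(p∘z) is evaluated in two ways: the sum over p does not depend on z, since
  -- every injective z is q∘x for some q in S_d, and the sum over z does not depend on p.
  have h1 : ∀ z ∈ Finset.univ.filter fun z : Fin t → Fin d => z.Injective,
      ∑ p : Equiv.Perm (Fin d), G (p ∘ z) = ∑ p : Equiv.Perm (Fin d), G (p ∘ x) := by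
    intro z hz
    obtain ⟨q, hq⟩ := Equiv.Perm.exists_extending_pair x z hx (Finset.mem_filter.1 hz).2
    obtain rfl : q ∘ x = z := funext hq
    exact Fintype.sum_equiv (Equiv.mulRight q) _ _ fun p => rfl
  have h2 : ∀ p : Equiv.Perm (Fin d), ∑ z : Fin t → Fin d with z.Injective, G (p ∘ z) =
      ∑ z : Fin t → Fin d with z.Injective, G z := by
    intro p
    refine Finset.sum_bij' (fun z _ => p ∘ z) (fun z _ => ⇑p⁻¹ ∘ z) ?_ ?_ ?_ ?_ ?_
    · intro z hz
      rw [Finset.mem_filter] at hz ⊢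
      exact ⟨Finset.mem_univ _, p.injective.comp hz.2⟩
    · intro z hz
      rw [Finset.mem_filter] at hz ⊢
      exact ⟨Finset.mem_univ _, p.symm.injective.comp hz.2⟩
    · intro z _
      funext i
      simp
    · intro z _
      funext i
      simp
    · intro z _
      rfl
  have h3 := Finset.sum_congr rfl h1
  rw [Finset.sum_comm, Finset.sum_const, Finset.sum_congr rfl fun p _ => h2 p, Finset.sum_const,
    Finset.card_univ, Fintype.card_perm, Fintype.card_fin] at h3
  rw [Nat.cast_smul_eq_nsmul, Nat.cast_smul_eq_nsmul, h3, numDistinct]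

/-- The matrix unit `|x⟩⟨y|`. -/
noncomputable def ketbra (x y : Fin t → Fin d) : Tens d t →ₗ[ℂ] Tens d t :=
  (InnerProductSpace.rankOne ℂ (ket x) (ket y)).toLinearMap

theorem operator_induction {p : (Tens d t →ₗ[ℂ] Tens d t) → Prop}
    (hket : ∀ x y, p (ketbra x y)) (hzero : p 0) (hadd : ∀ S T, p S → p T → p (S + T))
    (hsmul : ∀ (a : ℂ) S, p S → p (a • S)) (S : Tens d t →ₗ[ℂ] Tens d t) : p S := by
  classical
  have h : S = ∑ y, ∑ x, (S (ket y) x) • ketbra x y := by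
    refine (EuclideanSpace.basisFun (Fin t → Fin d) ℂ).toBasis.ext fun z => ?_
    have hz : (EuclideanSpace.basisFun (Fin t → Fin d) ℂ).toBasis z = ket z := by simp [ket]
    rw [hz]
    conv_lhs => rw [eq_sum_smul_ket (S (ket z))]
    simp [LinearMap.sum_apply, ketbra, inner_ket_ket, ite_smul]
  rw [h]
  exact Finset.sum_induction _ p hadd hzero fun y _ =>
    Finset.sum_induction _ p hadd hzero fun x _ => hsmul _ _ (hket x y)

/-- The permutation-phase twirl of an operator on `(ℂ^d)^{⊗t}`. -/
noncomputable def pfTwirlTens (d t : ℕ) (S : Tens d t →ₗ[ℂ] Tens d t) :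
    Tens d t →ₗ[ℂ] Tens d t :=
  (Fintype.card (Equiv.Perm (Fin d) × (Fin d → Fin 2)) : ℂ)⁻¹ •
    ∑ ω, tensPow t (permPhase ω) ∘ₗ S ∘ₗ LinearMap.adjoint (tensPow t (permPhase ω))

theorem pfTwirlTens_add (S T : Tens d t →ₗ[ℂ] Tens d t) :
    pfTwirlTens d t (S + T) = pfTwirlTens d t S + pfTwirlTens d t T := by
  simp only [pfTwirlTens, LinearMap.add_comp, LinearMap.comp_add, Finset.sum_add_distrib, smul_add]

theorem pfTwirlTens_smul (a : ℂ) (S : Tens d t →ₗ[ℂ] Tens d t) :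
    pfTwirlTens d t (a • S) = a • pfTwirlTens d t S := by
  simp only [pfTwirlTens, LinearMap.smul_comp, LinearMap.comp_smul, ← Finset.smul_sum]
  rw [smul_comm]

theorem pfTwirlTens_ketbra {x y : Fin t → Fin d} (hx : x.Injective) (hy : y.Injective) :
    pfTwirlTens d t (ketbra x y) = (d.factorial : ℂ)⁻¹ •
      if Finset.univ.image x = Finset.univ.image y then
        ∑ p : Equiv.Perm (Fin d), ketbra (p ∘ x) (p ∘ y) else 0 := by
  have hterm : ∀ ω : Equiv.Perm (Fin d) × (Fin d → Fin 2),
      tensPow t (permPhase ω) ∘ₗ ketbra x y ∘ₗ LinearMap.adjoint (tensPow t (permPhase ω)) =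
        ((∏ i, (-1 : ℂ) ^ (ω.2 (x i) : ℕ)) * ∏ i, (-1 : ℂ) ^ (ω.2 (y i) : ℕ)) •
          ketbra (ω.1 ∘ x) (ω.1 ∘ y) := by
    intro ω
    rw [ketbra, comp_rankOne_comp_adjoint, tensPow_permPhase_ket, tensPow_permPhase_ket]
    ext1 u
    simp [ketbra, map_prod, smul_smul, mul_assoc]
  simp only [pfTwirlTens, hterm, Fintype.sum_prod_type]
  simp only [← Finset.sum_smul, sum_phases x y hx hy, Fintype.card_prod, Fintype.card_perm,
    Fintype.card_fin, Fintype.card_pi, Finset.prod_const, Finset.card_univ]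
  split_ifs
  · rw [← Finset.smul_sum, smul_smul]
    congr 1
    push_cast
    rw [mul_inv, mul_assoc, inv_mul_cancel₀ (pow_ne_zero _ two_ne_zero), mul_one]
  · simp

theorem distinctProj_comp_permOp_eq_sum_ketbra (τ : Equiv.Perm (Fin t)) :
    open scoped Classical in
    distinctProj d t ∘ₗ permOp τ⁻¹ =
      ∑ z : Fin t → Fin d with z.Injective, ketbra z (z ∘ ⇑τ⁻¹) := by
  classical
  ext1 u
  simp only [distinctProj, LinearMap.comp_apply, LinearMap.sum_apply]
  refine Finset.sum_congr (by congr) fun z _ => ?_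
  have h : inner ℂ (ket z) (permOp τ⁻¹ u) = inner ℂ (ket (z ∘ ⇑τ⁻¹)) u := by
    rw [← permOp_ket, inner_permOp_left]
  simp [ketbra, h]

theorem trace_permOp_comp_ketbra (τ : Equiv.Perm (Fin t)) (x y : Fin t → Fin d) :
    LinearMap.trace ℂ _ (permOp τ ∘ₗ ketbra x y) = if y = x ∘ ⇑τ⁻¹ then 1 else 0 := by
  have h : permOp τ ∘ₗ ketbra x y =
      (InnerProductSpace.rankOne ℂ (ket (x ∘ ⇑τ⁻¹)) (ket y)).toLinearMap := by
    ext1 u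
    rw [← permOp_ket]
    simp [ketbra]
  rw [h, InnerProductSpace.trace_rankOne, inner_ket_ket]

theorem exists_perm_of_image_eq {x y : Fin t → Fin d} (hy : y.Injective)
    (h : Finset.univ.image x = Finset.univ.image y) :
    ∃ τ : Equiv.Perm (Fin t), y = x ∘ ⇑τ⁻¹ := by
  have hex : ∀ i, ∃ j, x j = y i := fun i => by
    have : y i ∈ Finset.univ.image x := by
      rw [h]
      exact Finset.mem_image_of_mem y (Finset.mem_univ i)
    simpa using this
  choose j hj using hex
  have hinj : j.Injective := fun a b hab => hy (by rw [← hj a, ← hj b, hab])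
  refine ⟨(Equiv.ofBijective j hinj.bijective_of_finite)⁻¹, ?_⟩
  funext i
  rw [inv_inv]
  exact (hj i).symm

/-- The trace is nonzero for at most one τ, namely when y = x∘τ⁻¹; such a τ exists exactly when the
two images agree. The orbit average of |x⟩⟨x∘τ⁻¹| is then the average over all distinct tuples. -/
theorem pfTwirlTens_ketbra_eq {x y : Fin t → Fin d} (hx : x.Injective) (hy : y.Injective) :
    pfTwirlTens d t (ketbra x y) = (numDistinct d t : ℂ)⁻¹ •
      ∑ τ, LinearMap.trace ℂ _ (permOp τ ∘ₗ ketbra x y) • (distinctProj d t ∘ₗ permOp τ⁻¹) := by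
  classical
  rw [pfTwirlTens_ketbra hx hy]
  simp only [trace_permOp_comp_ketbra]
  split_ifs with h
  · obtain ⟨τ, rfl⟩ := exists_perm_of_image_eq hy h
    have huniq : ∀ π : Equiv.Perm (Fin t), x ∘ ⇑τ⁻¹ = x ∘ ⇑π⁻¹ → π = τ := by
      intro π hπ
      rw [← inv_inj]
      ext k
      rw [hx (congrFun hπ k)]
    rw [Finset.sum_eq_single τ (fun π _ hπ => by
      rw [if_neg fun h => hπ (huniq π h), zero_smul]) (by simp), if_pos rfl, one_smul,
      distinctProj_comp_permOp_eq_sum_ketbra]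
    have hN : (numDistinct d t : ℂ) ≠ 0 := by
      rw [numDistinct, Nat.cast_ne_zero, Finset.card_ne_zero]
      exact ⟨x, by simpa using hx⟩
    have hd : (d.factorial : ℂ) ≠ 0 := Nat.cast_ne_zero.2 d.factorial_ne_zero
    have h := numDistinct_smul_sum_perm (fun z => ketbra z (z ∘ ⇑τ⁻¹)) hx
    rw [inv_smul_eq_iff₀ hd, smul_comm, eq_inv_smul_iff₀ hN]
    exact h
  · rw [Finset.sum_eq_zero, smul_zero, smul_zero]
    intro τ _
    rw [if_neg, zero_smul]
    rintro rfl
    apply h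
    ext a
    simp only [Finset.mem_image, Finset.mem_univ, true_and, Function.comp_apply]
    exact ⟨fun ⟨i, hi⟩ => ⟨τ i, by simpa using hi⟩, fun ⟨i, hi⟩ => ⟨_, hi⟩⟩

/-- The twirl of an operator `ΛSΛ` on the distinct subspace is its projection to the span of the
operators `Λ R_τ`. -/
theorem pfTwirlTens_distinct (S : Tens d t →ₗ[ℂ] Tens d t) :
    pfTwirlTens d t (distinctProj d t ∘ₗ S ∘ₗ distinctProj d t) = (numDistinct d t : ℂ)⁻¹ •
      ∑ τ, LinearMap.trace ℂ _ (permOp τ ∘ₗ distinctProj d t ∘ₗ S ∘ₗ distinctProj d t) •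
        (distinctProj d t ∘ₗ permOp τ⁻¹) := by
  have h0 : pfTwirlTens d t 0 = 0 := by simp [pfTwirlTens]
  induction S using operator_induction with
  | hket x y =>
    have h : distinctProj d t ∘ₗ ketbra x y ∘ₗ distinctProj d t =
        (InnerProductSpace.rankOne ℂ (distinctProj d t (ket x))
          (distinctProj d t (ket y))).toLinearMap := by
      rw [← comp_rankOne_comp_adjoint, adjoint_distinctProj, ketbra]
    rw [h]
    by_cases hx : x.Injective
    · by_cases hy : y.Injective
      · rw [distinctProj_ket_of_injective hx, distinctProj_ket_of_injective hy]
        exact pfTwirlTens_ketbra_eq hx hy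
      · simp [distinctProj_ket_of_not_injective hy, h0]
    · simp [distinctProj_ket_of_not_injective hx, h0]
  | hzero => simp [h0]
  | hadd S T hS hT =>
    simp only [LinearMap.add_comp, LinearMap.comp_add, pfTwirlTens_add, map_add, add_smul,
      Finset.sum_add_distrib, smul_add, hS, hT]
  | hsmul a S hS =>
    simp only [LinearMap.smul_comp, LinearMap.comp_smul, pfTwirlTens_smul, map_smul, smul_assoc,
      ← Finset.smul_sum, hS]
    rw [smul_comm]

/-- The partial trace over `W_μ` of the block of an operator on `(ℂ^d)^{⊗t}`. -/
noncomputable def blockTraceTens (d : ℕ) (μ : t.Partition) (S : Tens d t →ₗ[ℂ] Tens d t) :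
    Specht μ →ₗ[ℂ] Specht μ :=
  partialTrace (Weyl d μ) (Specht μ) (LinearMap.adjoint (embed d μ) ∘ₗ S ∘ₗ embed d μ)

/-- On each block R_τ acts as 1 ⊗ R^{(μ)}_τ, so only the partial trace over W_μ is seen. -/
theorem trace_permOp_comp (τ : Equiv.Perm (Fin t)) (S : Tens d t →ₗ[ℂ] Tens d t) :
    LinearMap.trace ℂ _ (permOp τ ∘ₗ S) =
      ∑ μ : t.Partition, LinearMap.trace ℂ _ (spechtAct μ τ ∘ₗ blockTraceTens d μ S) := by
  have h : permOp τ ∘ₗ S = ∑ μ : t.Partition,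
      ((embed d μ ∘ₗ TensorProduct.map LinearMap.id (spechtAct μ τ)) ∘ₗ
        LinearMap.adjoint (embed d μ)) ∘ₗ S := by
    ext1 u
    conv_lhs => rw [eq_sum_comp_embed (permOp τ)]
    simp only [LinearMap.comp_apply, LinearMap.sum_apply, ← permOp_comp_embed]
  rw [h, map_sum]
  refine Finset.sum_congr rfl fun μ _ => ?_
  rw [LinearMap.comp_assoc, LinearMap.comp_assoc, LinearMap.trace_comp_comm', LinearMap.comp_assoc,
    trace_map_id_comp, LinearMap.comp_assoc, blockTraceTens]

theorem sum_trace_smul_sum (Y : ∀ ν : t.Partition, Specht ν →ₗ[ℂ] Specht ν) (μ : t.Partition) :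
    ∑ τ, (∑ ν, LinearMap.trace ℂ _ (spechtAct ν τ ∘ₗ Y ν)) • spechtAct μ τ⁻¹ =
      ((t.factorial : ℂ) / Module.finrank ℂ (Specht μ)) • Y μ := by
  classical
  simp only [Finset.sum_smul]
  rw [Finset.sum_comm, Finset.sum_eq_single μ (fun ν _ hν =>
    sum_trace_smul_spechtAct_of_ne hν.symm (Y ν)) (by simp), sum_trace_smul_spechtAct]

theorem pfTwirlTens_eq_sum (S : Tens d t →ₗ[ℂ] Tens d t) :
    pfTwirlTens d t (distinctProj d t ∘ₗ S ∘ₗ distinctProj d t) = ∑ μ : t.Partition, embed d μ ∘ₗ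
      TensorProduct.map (sigma d μ)
        (blockTraceTens d μ (distinctProj d t ∘ₗ S ∘ₗ distinctProj d t)) ∘ₗ
          LinearMap.adjoint (embed d μ) := by
  rw [pfTwirlTens_distinct]
  generalize distinctProj d t ∘ₗ S ∘ₗ distinctProj d t = X
  have h : ∀ μ : t.Partition, TensorProduct.map (sigma d μ) (blockTraceTens d μ X) =
      ∑ τ, ((numDistinct d t : ℂ)⁻¹ * LinearMap.trace ℂ _ (permOp τ ∘ₗ X)) •
        TensorProduct.map (weylDistinct d μ) (spechtAct μ τ⁻¹) := by
    intro μ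
    have h1 := sum_trace_smul_sum (fun ν => blockTraceTens d ν X) μ
    simp only [← trace_permOp_comp] at h1
    -- This is where the normalization of σ_μ appears. With inverses of zero taken as zero, it
    -- remains valid for N = 0.
    have h2 : ((numDistinct d t : ℂ)⁻¹ * ((t.factorial : ℂ) / Module.finrank ℂ (Specht μ))) =
        (LinearMap.trace ℂ _ (weylDistinct d μ))⁻¹ := by
      rw [trace_weylDistinct, inv_div, mul_comm (numDistinct d t : ℂ), ← div_div, div_eq_inv_mul _
        (numDistinct d t : ℂ)]
    rw [sigma, TensorProduct.map_smul_left, ← h2, mul_smul, ← TensorProduct.map_smul_right, ← h1]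
    simp only [mul_smul, ← Finset.smul_sum]
    congr 1
    ext w v
    simp [LinearMap.sum_apply, TensorProduct.tmul_sum]
  ext1 u
  simp only [h, distinctProj_comp_permOp, LinearMap.smul_apply, LinearMap.sum_apply,
    LinearMap.comp_apply, map_sum, map_smul, Finset.smul_sum, smul_smul]
  exact Finset.sum_comm

end Twirl

/-! ### Composite systems -/

section Composite

variable {d t : ℕ} (E : Type*) [NormedAddCommGroup E] [InnerProductSpace ℂ E]

theorem blockProj_comp_embed (d : ℕ) (μ : t.Partition) : blockProj d μ ∘ₗ embed d μ = embed d μ :=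
  LinearMap.ext fun x => Submodule.starProjection_eq_self_iff.2 ⟨x, rfl⟩

/-- Compression by J_μ already restricts to the block, so the projections in `blockTrace` can be
dropped. -/
theorem adjoint_embed_comp_blockProj (d : ℕ) (μ : t.Partition) :
    LinearMap.adjoint (embed d μ) ∘ₗ blockProj d μ = LinearMap.adjoint (embed d μ) := by
  have h : LinearMap.adjoint (blockProj d μ) = blockProj d μ :=
    ((LinearMap.eq_adjoint_iff _ _).2
      fun u v => Submodule.inner_starProjection_left_eq_right _ u v).symm
  have h2 := congrArg LinearMap.adjoint (blockProj_comp_embed d μ)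
  rwa [LinearMap.adjoint_comp, h] at h2

theorem fromBlock_add (μ : t.Partition)
    (Y Z : Weyl d μ ⊗[ℂ] (Specht μ ⊗[ℂ] E) →ₗ[ℂ] Weyl d μ ⊗[ℂ] (Specht μ ⊗[ℂ] E)) :
    fromBlock E d μ (Y + Z) = fromBlock E d μ Y + fromBlock E d μ Z := by
  simp only [fromBlock, LinearMap.add_comp, LinearMap.comp_add]

theorem numDistinct_ne_zero {φ : Tens d t ⊗[ℂ] E} (hφ : φ ≠ 0)
    (hΛ : LinearMap.rTensor E (distinctProj d t) φ = φ) : numDistinct d t ≠ 0 := by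
  classical
  intro h
  rw [numDistinct, Finset.card_eq_zero] at h
  have h0 : distinctProj d t = 0 := by
    rw [distinctProj]
    exact Finset.sum_eq_zero fun x hx => by
      have : x ∈ Finset.univ.filter fun x : Fin t → Fin d => x.Injective := by simpa using hx
      rw [h] at this
      simp at this
  rw [h0, LinearMap.rTensor_zero, LinearMap.zero_apply] at hΛ
  exact hφ hΛ.symm

theorem fromBlock_map (μ : t.Partition) (A : Weyl d μ →ₗ[ℂ] Weyl d μ)
    (B : Specht μ →ₗ[ℂ] Specht μ) (T : E →ₗ[ℂ] E) :
    fromBlock E d μ (TensorProduct.map A (TensorProduct.map B T)) =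
      TensorProduct.map (embed d μ ∘ₗ TensorProduct.map A B ∘ₗ LinearMap.adjoint (embed d μ)) T := by
  have h : (TensorProduct.assoc ℂ (Weyl d μ) (Specht μ) E).symm.toLinearMap ∘ₗ
      TensorProduct.map A (TensorProduct.map B T) ∘ₗ
        (TensorProduct.assoc ℂ (Weyl d μ) (Specht μ) E).toLinearMap =
      TensorProduct.map (TensorProduct.map A B) T := by
    ext w v e
    simp
  have h' := fun u => LinearMap.congr_fun h u
  simp only [LinearMap.comp_apply, LinearEquiv.coe_coe] at h'
  refine TensorProduct.ext' fun a e => ?_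
  simp [fromBlock, embedE, embedEAdj, h']

variable [FiniteDimensional ℂ E]

theorem pfTwirl_map (S : Tens d t →ₗ[ℂ] Tens d t) (T : E →ₗ[ℂ] E) :
    pfTwirl E d t (TensorProduct.map S T) = TensorProduct.map (pfTwirlTens d t S) T := by
  rw [pfTwirl, twirl, pfTwirlTens, TensorProduct.map_smul_left]
  congr 1
  refine TensorProduct.ext' fun a e => ?_
  simp [LinearMap.sum_apply, TensorProduct.sum_tmul, permPhase]

theorem pfTwirl_add (X Y : Tens d t ⊗[ℂ] E →ₗ[ℂ] Tens d t ⊗[ℂ] E) :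
    pfTwirl E d t (X + Y) = pfTwirl E d t X + pfTwirl E d t Y := by
  simp only [pfTwirl, twirl, LinearMap.add_comp, LinearMap.comp_add, Finset.sum_add_distrib,
    smul_add]

theorem blockTrace_map (μ : t.Partition) (S : Tens d t →ₗ[ℂ] Tens d t) (T : E →ₗ[ℂ] E) :
    blockTrace E d μ (TensorProduct.map S T) = TensorProduct.map (blockTraceTens d μ S) T := by
  rw [blockTraceTens, ← partialTrace_assoc, blockTrace]
  congr 1
  rw [← adjoint_embed_comp_blockProj, LinearMap.comp_assoc]
  conv_rhs => enter [2, 1, 1, 2, 2, 2]; rw [← blockProj_comp_embed]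
  ext w v e
  simp [toBlock, embedE, embedEAdj]

theorem blockTrace_add (μ : t.Partition) (X Y : Tens d t ⊗[ℂ] E →ₗ[ℂ] Tens d t ⊗[ℂ] E) :
    blockTrace E d μ (X + Y) = blockTrace E d μ X + blockTrace E d μ Y := by
  simp only [blockTrace, toBlock, LinearMap.add_comp, LinearMap.comp_add, map_add]

/-- The permutation-phase twirl of an operator supported on the distinct subspace. -/
theorem pfTwirl_eq_sum (X : Tens d t ⊗[ℂ] E →ₗ[ℂ] Tens d t ⊗[ℂ] E) :
    pfTwirl E d t (LinearMap.rTensor E (distinctProj d t) ∘ₗ X ∘ₗ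
      LinearMap.rTensor E (distinctProj d t)) = ∑ μ : t.Partition, fromBlock E d μ
        (TensorProduct.map (sigma d μ) (blockTrace E d μ
          (LinearMap.rTensor E (distinctProj d t) ∘ₗ X ∘ₗ
            LinearMap.rTensor E (distinctProj d t)))) := by
  induction X using tensor_operator_induction with
  | hmap S T =>
    have h : LinearMap.rTensor E (distinctProj d t) ∘ₗ TensorProduct.map S T ∘ₗ
        LinearMap.rTensor E (distinctProj d t) =
          TensorProduct.map (distinctProj d t ∘ₗ S ∘ₗ distinctProj d t) T := by
      rw [LinearMap.map_comp_rTensor, LinearMap.rTensor_comp_map]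
    rw [h, pfTwirl_map, pfTwirlTens_eq_sum]
    simp only [blockTrace_map, fromBlock_map]
    refine TensorProduct.ext' fun a e => ?_
    simp [LinearMap.sum_apply, TensorProduct.sum_tmul]
  | hadd Y Z hY hZ =>
    simp only [LinearMap.add_comp, LinearMap.comp_add, pfTwirl_add, blockTrace_add,
      TensorProduct.map_add_right, fromBlock_add, Finset.sum_add_distrib, hY, hZ]

end Composite

end SchurWeyl

theorem mainTheorem4 (d t : ℕ) (E : Type*) [NormedAddCommGroup E] [InnerProductSpace ℂ E]
    [FiniteDimensional ℂ E] (φ : SchurWeyl.Tens d t ⊗[ℂ] E) (hφ : ‖φ‖ = 1)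
    (hΛ : LinearMap.rTensor E (SchurWeyl.distinctProj d t) φ = φ) :
    -- the Schur-Weyl decomposition: `(ℂ^d)^{⊗t}` is the orthogonal direct sum of `W_μ ⊗ V_μ`
    (∀ (μ : t.Partition) x, ‖SchurWeyl.embed d μ x‖ = ‖x‖) ∧
    (∀ μ ν : t.Partition, μ ≠ ν → SchurWeyl.blockSpace d μ ⟂ SchurWeyl.blockSpace d ν) ∧
    (⨆ μ : t.Partition, SchurWeyl.blockSpace d μ) = ⊤ ∧
    -- `Λ = ∑_μ Λ^{(μ)} ⊗ 1_{V_μ}`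
    SchurWeyl.distinctProj d t = ∑ μ : t.Partition, SchurWeyl.embed d μ ∘ₗ
      TensorProduct.map (SchurWeyl.weylDistinct d μ) LinearMap.id ∘ₗ
        LinearMap.adjoint (SchurWeyl.embed d μ) ∧
    -- `Λ^{(μ)}` is a nonzero orthogonal projection, so that `σ_μ` is a maximally mixed state
    (∀ μ : t.Partition, (SchurWeyl.weylDistinct d μ).IsSymmetricProjection ∧
      LinearMap.trace ℂ (SchurWeyl.Weyl d μ) (SchurWeyl.weylDistinct d μ) ≠ 0) ∧
    -- the action of the permutation-phase twirl
    SchurWeyl.pfTwirl E d t (InnerProductSpace.rankOne ℂ φ φ).toLinearMap =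
      ∑ μ : t.Partition, SchurWeyl.fromBlock E d μ
        (TensorProduct.map (SchurWeyl.sigma d μ)
          (SchurWeyl.blockTrace E d μ (InnerProductSpace.rankOne ℂ φ φ).toLinearMap)) := by
  refine ⟨fun μ => SchurWeyl.norm_embed, fun μ ν => SchurWeyl.blockSpace_isOrtho d,
    SchurWeyl.iSup_blockSpace d t, SchurWeyl.distinctProj_eq_sum d t,
    fun μ => ⟨SchurWeyl.weylDistinct_isSymmetricProjection d μ, ?_⟩, ?_⟩
  · have hφ0 : φ ≠ 0 := by
      rintro rfl
      simp at hφ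
    rw [SchurWeyl.trace_weylDistinct]
    exact div_ne_zero (mul_ne_zero
      (Nat.cast_ne_zero.2 (SchurWeyl.numDistinct_ne_zero E hφ0 hΛ))
      SchurWeyl.finrank_specht_ne_zero) (Nat.cast_ne_zero.2 t.factorial_ne_zero)
  -- Since Λφ = φ, the state |φ⟩⟨φ| equals its own compression by Λ, which is the form that
  -- `pfTwirl_eq_sum` treats.
  · have h := SchurWeyl.comp_rankOne_comp_adjoint
      (LinearMap.rTensor E (SchurWeyl.distinctProj d t)) φ φ
    rw [LinearMap.adjoint_rTensor, SchurWeyl.adjoint_distinctProj, hΛ] at h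
    have h2 := SchurWeyl.pfTwirl_eq_sum E (InnerProductSpace.rankOne ℂ φ φ).toLinearMap
    rwa [h] at h2
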